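/- **Multi-Poisson ensemble.** Let $\Lambda(x)=\sum_{l=2}^{l_{\max}}\Lambda_l x^l$ and $P(x)=\sum_{k=2}^{k_{\max}}P_kx^k$ be polynomials with non-negative coefficients and $\Lambda(1)=P(1)=1$, let $\gamma>0$, and put $t_{\max}=\max\{\lfloor\Lambda'(1)/\gamma\rfloor-1,\,0\}$ and $[x]_+=\max\{x,0\}$. Let $n\ge1$ be such that all $n\Lambda_l$ are integers (only such $n$ are considered below). A random Tanner graph (bipartite multigraph) from the multi-Poisson ensemble $(n,\Lambda,P,\gamma)$ has variable nodes $[n]$, which are partitioned uniformly at random into classes $\mathcal V_l$ with $|\mathcal V_l|=n\Lambda_l$; set $d_i(0)=l$ for $i\in\mathcal V_l$, and start without check nodes. In round $t=0,\dots,t_{\max}-1$, independently for each $2\le k\le k_{\max}$, a number $m_k^{(t)}\sim\mathrm{Poisson}(n\gamma P_k/P'(1))$ of check nodes of degree $k$ is added; each of them is connected to $k$ variable nodes chosen independently (so possibly with repetition) from the distribution $w_i(t)=[d_i(t)]_+/\sum_j[d_j(t)]_+$. Then $d_i(t+1)=d_i(t)-\Delta_i(t)$, where $\Delta_i(t)$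 is the number of times $i$ was chosen in round $t$. If $\sum_j[d_j(t)]_+=0$ at the start of a round, so that $w(t)$ is undefined, then the check nodes of that round and their neighbours are chosen by an arbitrary fixed (possibly randomized) rule. Let $\hat\Lambda_l$, $l\ge 0$, be the fraction of variable nodes that have degree $l$, counted with multiplicity, in the resulting graph. **Limit profile.** For $l\in\{2,\dots,l_{\max}\}$ and $d\in\mathbb Z$ let $\Omega^{(0)}_{l,d}=\Lambda_l\,\mathbb I_{\{d=l\}}$ and, for $0\le t<t_{\max}$, $$\Omega^{(t+1)}_{l,d}=\sum_{d'\ge d}\Omega^{(t)}_{l,d'}\,W_t(d'-d\,|\,d'),\qquad W_t(\Delta|d)=e^{-\lambda_t(d)}\frac{\lambda_t(d)^\Delta}{\Delta!},\qquad \lambda_t(d)=\frac{\gamma[d]_+}{\sum_{l,d'}\Omega^{(t)}_{l,d'}[d']_+}.$$ Here $\Omega^{(t)}_{l,d}=0$ for $d>l_{\max}$, so all these sums are finite. Put $\Lambda^{(\gamma)}_l=\sum_{l'}\Omega^{(t_{\max})}_{l',\,l'-l}$ for $l\ge 0$. **Lemma.** There exist $A,B>0$, depending only on $\Lambda$, $P$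 and $\gamma$, such that (whatever rule is used in rounds where $w$ is undefined) (I) $\lim_{n\to\infty}\mathbb E\,\hat\Lambda_l=\Lambda^{(\gamma)}_l$ for every $l\ge0$; (II) $\lim_{n\to\infty}\|\mathbb E\,\hat\Lambda-\Lambda^{(\gamma)}\|=0$, where $\|\mu-\nu\|=\frac12\sum_{l\ge0}|\mu_l-\nu_l|$ is the total variation distance; (III) $\mathbb P\{|\hat\Lambda_l-\Lambda^{(\gamma)}_l|\ge\varepsilon\}\le A\,e^{-Bn\varepsilon^2}$ for all $l\ge 0$, all $\varepsilon>0$ and all $n$ as above. -/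

import Mathlib

open Filter Topology MeasureTheory ProbabilityTheory

noncomputable section

namespace MultiPoisson

/-- A design degree sequence: a polynomial with non-negative coefficients summing to `1`,
whose terms all have degree at least `2`.  Its maximum degree is its `natDegree`. -/
structure DegreeSequence where
  poly : Polynomial ℝ
  coeff_nonneg : ∀ l, 0 ≤ poly.coeff l
  coeff_zero : poly.coeff 0 = 0
  coeff_one : poly.coeff 1 = 0
  eval_one : poly.eval 1 = 1

namespace DegreeSequence

/-- The fraction of nodes of degree `l`. -/
def coeff (D : DegreeSequence) (l : ℕ) : ℝ := D.poly.coeff l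

/-- The maximum degree. -/
def maxDeg (D : DegreeSequence) : ℕ := D.poly.natDegree

/-- The average degree `D'(1)`. -/
def mean (D : DegreeSequence) : ℝ := (Polynomial.derivative D.poly).eval 1

end DegreeSequence

/-- The number of rounds `⌊Λ'(1) / γ⌋ - 1` (no round at all if this is negative). -/
def numRounds (Λ : DegreeSequence) (γ : ℝ) : ℕ := ⌊Λ.mean / γ⌋₊ - 1

/-! ### Tanner graphs -/

/-- A check node, carrying its label `(index, degree, round)` and the list of the variable nodes
it is connected to (repetitions are multiple edges). -/
structure CheckNode (n : ℕ) where
  index : ℕ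
  degree : ℕ
  round : ℕ
  nbrs : List (Fin n)

/-- A Tanner graph on the variable nodes `Fin n`, given by its check nodes. -/
abbrev TannerGraph (n : ℕ) := List (CheckNode n)

/-- The degree of the variable node `i`: the number of edges at `i`, with multiplicity. -/
def varDegree {n : ℕ} (G : TannerGraph n) (i : Fin n) : ℕ :=
  (G.map fun a => a.nbrs.count i).sum

/-- The degree profile: the fraction of variable nodes which have degree `l`. -/
def degreeProfile {n : ℕ} (G : TannerGraph n) (l : ℕ) : ℝ :=
  ((Finset.univ.filter fun i : Fin n => varDegree G i = l).card : ℝ) / n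

/-! ### The multi-Poisson ensemble -/

/-- The positive blocklengths `n` for which all the `n Λ_l` are integers. -/
def Blocklength (Λ : DegreeSequence) : Type :=
  {n : ℕ // 0 < n ∧ ∀ l, ∃ k : ℕ, (n : ℝ) * Λ.coeff l = k}

/-- The ways to split the `n` variable nodes into classes `V_l` of size `n Λ_l`: the node `i` is
in the class `V_(f i)`. -/
def assignments (Λ : DegreeSequence) (n : ℕ) : Finset (Fin n → Fin (Λ.maxDeg + 1)) :=
  open Classical in
  Finset.univ.filter fun f => ∀ l : Fin (Λ.maxDeg + 1),
    ((Finset.univ.filter fun i => f i = l).card : ℝ) = n * Λ.coeff l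

theorem assignments_nonempty (Λ : DegreeSequence) (n : Blocklength Λ) :
    (assignments Λ n.1).Nonempty := by
  choose k hk using n.2.2
  revert hk
  generalize n.1 = n
  intro hk
  have hsum : ∑ l : Fin (Λ.maxDeg + 1), k l = n := by
    have h1 : ∑ l : Fin (Λ.maxDeg + 1), Λ.coeff l = 1 := by
      have := Λ.eval_one
      rw [Polynomial.eval_eq_sum_range, Finset.sum_range] at this
      simp only [one_pow, mul_one] at this
      exact this
    have h2 : ((∑ l : Fin (Λ.maxDeg + 1), k l : ℕ) : ℝ) = n := by
      push_cast
      simp_rw [← hk]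
      rw [← Finset.mul_sum, h1, mul_one]
    exact_mod_cast h2
  have e : Fin n ≃ Σ l : Fin (Λ.maxDeg + 1), Fin (k l) :=
    Fintype.equivOfCardEq (by simp [hsum])
  refine ⟨fun i => (e i).1, ?_⟩
  simp only [assignments, Finset.mem_filter, Finset.mem_univ, true_and]
  intro l
  rw [hk]
  norm_cast
  have h3 : (Finset.univ.filter fun i => (e i).1 = l).card =
      (Finset.univ.filter fun x : Σ l : Fin (Λ.maxDeg + 1), Fin (k l) => x.1 = l).card :=
    Finset.card_bij (fun i _ => e i) (by simp) (by simp)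
      (fun b hb => ⟨e.symm b, by simpa using hb, by simp⟩)
  have h4 : (Finset.univ.filter fun x : Σ l : Fin (Λ.maxDeg + 1), Fin (k l) => x.1 = l) =
      (Finset.univ : Finset (Fin (k l))).map
        ⟨fun a => (⟨l, a⟩ : Σ l : Fin (Λ.maxDeg + 1), Fin (k l)), fun a b h => by simpa using h⟩ := by
    ext ⟨m, a⟩
    simp only [Finset.mem_filter, Finset.mem_univ, true_and, Finset.mem_map]
    constructor
    · rintro rfl
      exact ⟨a, rfl⟩
    · rintro ⟨x, hx⟩
      exact (congrArg Sigma.fst hx).symm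
  rw [h3, h4, Finset.card_map, Finset.card_univ, Fintype.card_fin]

/-- The state of the construction: the numbers `d_i(t)` of free sockets and the graph so far. -/
structure State (n : ℕ) where
  free : Fin n → ℤ
  graph : TannerGraph n

/-- The total weight `∑_j [d_j]_+`. -/
def totalFree {n : ℕ} (d : Fin n → ℤ) : ℕ := ∑ j, (d j).toNat

/-- The distribution `w_i = [d_i]_+ / ∑_j [d_j]_+` on the variable nodes. -/
def nodeLaw {n : ℕ} (d : Fin n → ℤ) (h : totalFree d ≠ 0) : PMF (Fin n) :=
  PMF.normalize (fun i => ((d i).toNat : ENNReal))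
    (by rw [tsum_fintype]; exact_mod_cast h)
    (by rw [tsum_fintype]; exact_mod_cast ENNReal.natCast_ne_top (totalFree d))

/-- Independent draws, one from each law of the list. -/
def independentDraws {α : Type} : List (PMF α) → PMF (List α)
  | [] => PMF.pure []
  | p :: ps => p.bind fun a => (independentDraws ps).map fun as => a :: as

/-- The Poisson distribution of mean `r`, for `r ≥ 0`. -/
def poissonLaw (r : ℝ) : PMF ℕ := (poissonMeasure r.toNNReal).toPMF

/-- The check nodes of degree `k` added in round `t`: a Poisson number of mean `n γ P_k / P'(1)`,
each choosing `k` variable nodes independently from the law `w`. -/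
def checksOfDegree {n : ℕ} (P : DegreeSequence) (γ : ℝ) (w : PMF (Fin n)) (t k : ℕ) :
    PMF (List (CheckNode n)) :=
  (poissonLaw (n * γ * P.coeff k / P.mean)).bind fun m =>
    independentDraws ((List.range m).map fun a =>
      (independentDraws (List.replicate k w)).map fun nb => ⟨a, k, t, nb⟩)

/-- All the check nodes added in round `t`, independently over the degrees `2 ≤ k ≤ k_max`. -/
def roundChecks {n : ℕ} (P : DegreeSequence) (γ : ℝ) (w : PMF (Fin n)) (t : ℕ) :
    PMF (List (CheckNode n)) :=
  (independentDraws ((List.Ico 2 (P.maxDeg + 1)).map fun k => checksOfDegree P γ w t k)).map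
    List.flatten

/-- Add check nodes to the graph and decrease each `d_i` by the number of times `i` was chosen. -/
def State.add {n : ℕ} (s : State n) (C : List (CheckNode n)) : State n where
  free := fun i => s.free i - varDegree C i
  graph := s.graph ++ C

/-- What to add in a round `t` that starts from a state with `∑_j [d_j]_+ = 0`, where the
distribution `w` is undefined and the construction fails: an arbitrary rule, possibly random. -/
abbrev FailureRule (n : ℕ) := ℕ → State n → PMF (List (CheckNode n))

/-- One round of the construction. -/
def step {n : ℕ} (P : DegreeSequence) (γ : ℝ) (F : FailureRule n) (t : ℕ) (s : State n) :
    PMF (State n) :=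
  (if h : totalFree s.free ≠ 0 then roundChecks P γ (nodeLaw s.free h) t else F t s).map s.add

/-- The law of the initial state: no check node, and `d_i(0) = l` for `i` in `V_l`, where the
partition `(V_l)` with `|V_l| = n Λ_l` is uniformly random. -/
def initialLaw (Λ : DegreeSequence) (n : Blocklength Λ) : PMF (State n.1) :=
  (PMF.uniformOfFinset (assignments Λ n.1) (assignments_nonempty Λ n)).map fun f =>
    ⟨fun i => ((f i : ℕ) : ℤ), []⟩

/-- The law of the state after `t` rounds. -/
def stateLaw (Λ P : DegreeSequence) (γ : ℝ) (n : Blocklength Λ) (F : FailureRule n.1) :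
    ℕ → PMF (State n.1)
  | 0 => initialLaw Λ n
  | t + 1 => (stateLaw Λ P γ n F t).bind (step P γ F t)

instance (n : ℕ) : MeasurableSpace (TannerGraph n) := ⊤

/-- The multi-Poisson ensemble `(n, Λ, P, γ)`. -/
def ensemble (Λ P : DegreeSequence) (γ : ℝ) (n : Blocklength Λ) (F : FailureRule n.1) :
    Measure (TannerGraph n.1) :=
  ((stateLaw Λ P γ n F (numRounds Λ γ)).map State.graph).toMeasure

/-- The expected degree profile. -/
def expectedProfile (Λ P : DegreeSequence) (γ : ℝ) (n : Blocklength Λ) (F : FailureRule n.1)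
    (l : ℕ) : ℝ :=
  ∫ G, degreeProfile G l ∂(ensemble Λ P γ n F)

/-- The limit `n → ∞` along the blocklengths of the ensemble. -/
def blocklengthLimit (Λ : DegreeSequence) : Filter (Blocklength Λ) :=
  comap (fun n => n.1) atTop

/-! ### The asymptotic degree profile -/

/-- `λ(d) = γ [d]_+ / ∑_{l, d'} Ω_{l, d'} [d']_+`, for `Ω` supported on `d' ≤ l ≤ L`. -/
def kernelMean (L : ℕ) (γ : ℝ) (Ω : ℕ → ℤ → ℝ) (d : ℤ) : ℝ :=
  γ * (d.toNat : ℝ) /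
    ∑ l ∈ Finset.range (L + 1), ∑ d' ∈ Finset.Icc (0 : ℤ) L, Ω l d' * (d'.toNat : ℝ)

/-- The Poisson kernel `W(Δ | d)`. -/
def kernel (L : ℕ) (γ : ℝ) (Ω : ℕ → ℤ → ℝ) (Δ : ℕ) (d : ℤ) : ℝ :=
  Real.exp (-kernelMean L γ Ω d) * kernelMean L γ Ω d ^ Δ / (Nat.factorial Δ : ℝ)

/-- The distributions `Ω^(t)_{l, d}`, which vanish for `d > l_max`
(so that the sum over `d' ≥ d` stops at `l_max`). -/
def omega (Λ : DegreeSequence) (γ : ℝ) : ℕ → ℕ → ℤ → ℝ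
  | 0 => fun l d => if d = l then Λ.coeff l else 0
  | t + 1 => fun l d => ∑ d' ∈ Finset.Icc d (Λ.maxDeg : ℤ),
      omega Λ γ t l d' * kernel Λ.maxDeg γ (omega Λ γ t) (d' - d).toNat d'

/-- The asymptotic degree profile `Λ^(γ)_l = ∑_{l'} Ω^(t_max)_{l', l' - l}`. -/
def limitProfile (Λ : DegreeSequence) (γ : ℝ) (l : ℕ) : ℝ :=
  ∑ l' ∈ Finset.range (Λ.maxDeg + 1), omega Λ γ (numRounds Λ γ) l' ((l' : ℤ) - l)

/-- The total variation distance, as an extended non-negative number. -/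
def tvDist (μ ν : ℕ → ℝ) : ENNReal := (∑' l, ENNReal.ofReal |μ l - ν l|) / 2

end MultiPoisson

end

noncomputable section

namespace MultiPoisson

/-! The fraction of nodes of class `l` with `d` free sockets is followed round by round. The class
of a node is its number of free sockets plus its current degree, so the final degree profile is a
finite sum of such fractions, and it suffices to show that each one is exponentially concentrated
around `omega Λ γ t l d`.

Within a round, a fixed state gives weights `W i` of order `1/n`, and all sockets together make a
random number `E` of independent picks, of mean `n γ`. The central object is `potential`: at clock
`x` and current counts `c`, it is the expected number of nodes of `I` that reach their target count
`a i` if the remaining picks were independent Poisson of means `x * W i`. At clock `0` it is the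
true count; at clock `n γ` and no picks it is the prediction of the limit recursion. One pick
together with one unit of clock changes it by at most `2`, with mean change at most `2 max W`, since
replacing a Bernoulli by a Poisson variable of the same mean `w` costs `O(w²)`. So its exponential
is almost a supermartingale (`sum_mul_exp_potential_le`). The potential is `1`-Lipschitz in the
clock, which reduces the fluctuation of `E` to exponential moments of Poisson variables. A Chernoff
bound gives `exists_roundChecks_concentration`.

Between rounds, the limit recursion is Lipschitz near `omega` (`exists_stability`), because the
limiting mass of free sockets is positive (`freeMass_pos`). The same positivity keeps the failure
rule out of play except on an event of exponentially small probability, so the constants do not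
depend on the rule. Induction on the round gives (III). Then (I) follows since the deviations are
bounded by `1`, and (II) from (I) by Scheffé's lemma, as the limit profile has total mass `1`. -/

/-! ### Expectations of extended non-negative functions -/

/-- The expectation of `f` under the law `p`. -/
def expect {α : Type*} (p : PMF α) (f : α → ENNReal) : ENNReal := ∑' x, p x * f x

theorem expect_pure {α : Type*} (a : α) (f : α → ENNReal) : expect (PMF.pure a) f = f a := by
  unfold expect
  rw [tsum_eq_single a]
  · simp
  · intro b hb
    simp [hb]

theorem expect_bind {α β : Type*} (p : PMF α) (q : α → PMF β) (f : β → ENNReal) :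
    expect (p.bind q) f = expect p fun a => expect (q a) f := by
  simp only [expect, PMF.bind_apply, ← ENNReal.tsum_mul_right, ← ENNReal.tsum_mul_left]
  rw [ENNReal.tsum_comm]
  simp only [mul_assoc]

theorem expect_map {α β : Type*} (p : PMF α) (g : α → β) (f : β → ENNReal) :
    expect (p.map g) f = expect p fun a => f (g a) := by
  rw [PMF.map, expect_bind]
  simp only [Function.comp_apply, expect_pure]

theorem expect_mono {α : Type*} (p : PMF α) {f g : α → ENNReal}
    (h : ∀ x ∈ p.support, f x ≤ g x) : expect p f ≤ expect p g := by
  refine ENNReal.tsum_le_tsum fun x => ?_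
  by_cases hx : p x = 0
  · simp [hx]
  · gcongr
    exact h x hx

theorem expect_const {α : Type*} (p : PMF α) (c : ENNReal) : expect p (fun _ => c) = c := by
  rw [expect, ENNReal.tsum_mul_right, p.tsum_coe, one_mul]

theorem expect_add {α : Type*} (p : PMF α) (f g : α → ENNReal) :
    expect p (fun x => f x + g x) = expect p f + expect p g := by
  simp only [expect, mul_add, ENNReal.tsum_add]

theorem expect_const_mul {α : Type*} (p : PMF α) (c : ENNReal) (f : α → ENNReal) :
    expect p (fun x => c * f x) = c * expect p f := by
  simp only [expect, ← ENNReal.tsum_mul_left]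
  exact tsum_congr fun x => mul_left_comm _ _ _

theorem expect_sum {α ι : Type*} (p : PMF α) (s : Finset ι) (f : ι → α → ENNReal) :
    expect p (fun x => ∑ i ∈ s, f i x) = ∑ i ∈ s, expect p (f i) := by
  classical
  induction s using Finset.induction_on with
  | empty => simp [expect]
  | insert a s ha ih => simp only [Finset.sum_insert ha, expect_add, ih]

theorem expect_comm {α β : Type*} (p : PMF α) (q : PMF β) (f : α → β → ENNReal) :
    (expect p fun a => expect q fun b => f a b) = expect q fun b => expect p fun a => f a b := by
  simp only [expect, ← ENNReal.tsum_mul_left]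
  rw [ENNReal.tsum_comm]
  simp only [mul_left_comm]

/-- The probability of a set under the law `p`. -/
def prob {α : Type*} (p : PMF α) (S : Set α) : ENNReal := expect p (S.indicator 1)

theorem toMeasure_eq_prob {α : Type*} [MeasurableSpace α] (p : PMF α) {S : Set α}
    (hS : MeasurableSet S) : p.toMeasure S = prob p S := by
  classical
  rw [p.toMeasure_apply hS, prob, expect]
  refine tsum_congr fun x => ?_
  by_cases hx : x ∈ S <;> simp [hx]

theorem prob_bind {α β : Type*} (p : PMF α) (q : α → PMF β) (S : Set β) :
    prob (p.bind q) S = expect p fun a => prob (q a) S := expect_bind p q _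

theorem prob_map {α β : Type*} (p : PMF α) (g : α → β) (S : Set β) :
    prob (p.map g) S = prob p (g ⁻¹' S) := expect_map p g _

theorem prob_le_one {α : Type*} (p : PMF α) (S : Set α) : prob p S ≤ 1 := by
  rw [← expect_const p 1]
  exact expect_mono p fun x _ => Set.indicator_le_self' (by simp) x

theorem prob_mono {α : Type*} (p : PMF α) {S T : Set α} (h : ∀ x ∈ p.support, x ∈ S → x ∈ T) :
    prob p S ≤ prob p T := by
  classical
  refine expect_mono p fun x hx => ?_
  by_cases hS : x ∈ S
  · simp [hS, h x hx hS]
  · simp [hS]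

theorem prob_biUnion_le {α ι : Type*} (p : PMF α) (s : Finset ι) (S : ι → Set α) :
    prob p (⋃ i ∈ s, S i) ≤ ∑ i ∈ s, prob p (S i) := by
  classical
  simp only [prob, ← expect_sum]
  refine expect_mono p fun x _ => ?_
  by_cases hx : x ∈ ⋃ i ∈ s, S i
  · simp only [hx, Set.indicator_of_mem]
    simp only [Set.mem_iUnion] at hx
    obtain ⟨i, hi, hxi⟩ := hx
    calc (1 : α → ENNReal) x = (S i).indicator 1 x := by simp [hxi]
      _ ≤ _ := Finset.single_le_sum (f := fun i => (S i).indicator (1 : α → ENNReal) x)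
        (fun _ _ => zero_le) hi
  · simp [hx]

theorem prob_eq_zero {α : Type*} (p : PMF α) {S : Set α} (h : ∀ x ∈ p.support, x ∉ S) :
    prob p S = 0 := by
  refine le_antisymm ((prob_mono p (T := ∅) fun x hx hS => (h x hx hS).elim).trans ?_) (zero_le)
  simp [prob, expect]

/-! ### Random picks and their counts -/

/-- The effect on a function of the counts of one pick from the law `w`. -/
def pickOp {n : ℕ} (w : PMF (Fin n)) (f : (Fin n → ℕ) → ENNReal) (c : Fin n → ℕ) : ENNReal :=
  expect w fun j => f (c + Pi.single j 1)

/-- The counts form a random walk, so successive groups of picks compose by adding exponents of one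
operator. Only the total number of picks then matters, not how they are grouped into check nodes. -/
theorem expect_picks {n : ℕ} (w : PMF (Fin n)) (k : ℕ) (f : (Fin n → ℕ) → ENNReal)
    (c : Fin n → ℕ) :
    expect (independentDraws (List.replicate k w)) (fun nb => f (c + fun i => nb.count i)) =
      (pickOp w)^[k] f c := by
  induction k generalizing c with
  | zero =>
    simp only [List.replicate_zero, independentDraws, expect_pure, Function.iterate_zero, id_eq]
    congr 1
  | succ k ih =>
    rw [List.replicate_succ, independentDraws, expect_bind, Function.iterate_succ_apply']
    unfold pickOp
    congr 1
    ext j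
    rw [expect_map]
    have := ih (c + Pi.single j 1)
    unfold pickOp at this
    rw [← this]
    congr 1
    ext nb
    congr 1
    ext i
    simp only [Pi.add_apply, List.count_cons, Pi.single_apply, beq_iff_eq, eq_comm (a := j)]
    ring

theorem varDegree_nil {n : ℕ} (i : Fin n) : varDegree ([] : TannerGraph n) i = 0 := rfl

theorem varDegree_cons {n : ℕ} (a : CheckNode n) (C : TannerGraph n) (i : Fin n) :
    varDegree (a :: C) i = a.nbrs.count i + varDegree C i := by
  simp [varDegree]

theorem varDegree_append {n : ℕ} (C D : TannerGraph n) (i : Fin n) :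
    varDegree (C ++ D) i = varDegree C i + varDegree D i := by
  simp [varDegree]

theorem expect_checks {n : ℕ} (w : PMF (Fin n)) (t k : ℕ) (as : List ℕ)
    (f : (Fin n → ℕ) → ENNReal) (c : Fin n → ℕ) :
    expect (independentDraws (as.map fun a =>
      (independentDraws (List.replicate k w)).map fun nb => (⟨a, k, t, nb⟩ : CheckNode n)))
      (fun C => f (c + varDegree C)) = (pickOp w)^[k * as.length] f c := by
  induction as generalizing c with
  | nil =>
    simp only [List.map_nil, independentDraws, expect_pure, List.length_nil, mul_zero,
      Function.iterate_zero, id_eq]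
    congr 1
  | cons a as ih =>
    rw [List.map_cons, independentDraws, expect_bind, expect_map]
    have h : k * (a :: as).length = k + k * as.length := by simp; ring
    rw [h, Function.iterate_add_apply, ← expect_picks]
    congr 1
    ext nb
    rw [expect_map, ← ih]
    congr 1
    funext C
    congr 1
    ext i
    simp only [Pi.add_apply, varDegree_cons]
    ring

theorem expect_checksOfDegree {n : ℕ} (P : DegreeSequence) (γ : ℝ) (w : PMF (Fin n)) (t k : ℕ)
    (f : (Fin n → ℕ) → ENNReal) (c : Fin n → ℕ) :
    expect (checksOfDegree P γ w t k) (fun C => f (c + varDegree C)) =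
      expect (poissonLaw (n * γ * P.coeff k / P.mean)) fun m => (pickOp w)^[k * m] f c := by
  rw [checksOfDegree, expect_bind]
  congr 1
  ext m
  rw [expect_checks, List.length_range]

theorem expect_poissonLaw_pow {r z : ℝ} (hr : 0 ≤ r) (hz : 0 ≤ z) :
    expect (poissonLaw r) (fun m => ENNReal.ofReal (z ^ m)) =
      ENNReal.ofReal (Real.exp (r * (z - 1))) := by
  have h : HasSum (fun m : ℕ => Real.exp (-r) * r ^ m / (m.factorial : ℝ) * z ^ m)
      (Real.exp (r * (z - 1))) := by
    have := (NormedSpace.expSeries_div_hasSum_exp (r * z)).mul_left (Real.exp (-r))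
    rw [← Real.exp_eq_exp_ℝ, ← Real.exp_add] at this
    convert! this using 1
    · ext m
      rw [mul_pow]
      ring
    · ring_nf
  rw [← h.tsum_eq, ENNReal.ofReal_tsum_of_nonneg (fun m => by positivity) h.summable]
  refine tsum_congr fun m => ?_
  rw [poissonLaw, Measure.toPMF_apply, poissonMeasure_singleton, Real.coe_toNNReal r hr,
    ENNReal.ofReal_mul (by positivity)]

/-- Turns a bound for a deterministic number `E` of picks into one for the random number made in a
round: independence over the degrees replaces `x ^ E` by a product of generating functions. Two
geometric terms are carried because `E` may fall on either side of its mean. The exponent `e` stores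
the picks of the degrees already treated in the induction. -/
theorem expect_draws_le {n : ℕ} (P : DegreeSequence) (γ : ℝ) (w : PMF (Fin n)) (t : ℕ)
    (f : (Fin n → ℕ) → ENNReal) (c : Fin n → ℕ) {K x K' x' : ENNReal}
    (hf : ∀ E, (pickOp w)^[E] f c ≤ K * x ^ E + K' * x' ^ E) (ks : List ℕ) (e : ℕ) :
    expect (independentDraws (ks.map fun k => checksOfDegree P γ w t k))
      (fun Cs => (pickOp w)^[e] f (c + varDegree Cs.flatten)) ≤
      K * (x ^ e * (ks.map fun k =>
        expect (poissonLaw (n * γ * P.coeff k / P.mean)) fun m => (x ^ k) ^ m).prod) +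
      K' * (x' ^ e * (ks.map fun k =>
        expect (poissonLaw (n * γ * P.coeff k / P.mean)) fun m => (x' ^ k) ^ m).prod) := by
  induction ks generalizing e with
  | nil =>
    simp only [List.map_nil, independentDraws, expect_pure, List.flatten_nil, List.prod_nil,
      mul_one]
    exact hf e
  | cons k ks ih =>
    rw [List.map_cons, independentDraws, expect_bind]
    have h1 : ∀ C : TannerGraph n,
        expect ((independentDraws (ks.map fun k => checksOfDegree P γ w t k)).map
          fun as => C :: as) (fun Cs => (pickOp w)^[e] f (c + varDegree Cs.flatten)) =
        expect (independentDraws (ks.map fun k => checksOfDegree P γ w t k)) fun Cs =>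
          (pickOp w)^[e] f ((c + varDegree Cs.flatten) + varDegree C) := by
      intro C
      rw [expect_map]
      congr 1
      funext Cs
      refine congrArg _ (funext fun i => ?_)
      simp only [List.flatten_cons, Pi.add_apply, varDegree_append]
      ring
    simp only [h1]
    -- By Tonelli the checks of degree `k` are averaged first; they add `k * m` to the exponent, and
    -- the induction hypothesis applies to the other degrees.
    rw [expect_comm]
    simp only [expect_checksOfDegree]
    rw [expect_comm]
    simp only [← Function.iterate_add_apply]
    refine (expect_mono _ fun m _ => ih (k * m + e)).trans (le_of_eq ?_)
    have h2 : ∀ L y Q : ENNReal, (expect (poissonLaw (n * γ * P.coeff k / P.mean)) fun m =>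
        L * (y ^ (k * m + e) * Q)) =
        L * (y ^ e * ((expect (poissonLaw (n * γ * P.coeff k / P.mean)) fun m =>
          (y ^ k) ^ m) * Q)) := by
      intro L y Q
      have : ∀ m : ℕ, L * (y ^ (k * m + e) * Q) = L * y ^ e * Q * (y ^ k) ^ m := by
        intro m
        rw [pow_add, pow_mul]
        ring
      simp only [this]
      rw [expect_const_mul]
      ring
    rw [expect_add, h2, h2]
    simp only [List.map_cons, List.prod_cons]

/-! ### Poisson weights -/

/-- The Poisson weight of mean `x` at the integer `a`. -/
def poissonWeight (x : ℝ) (a : ℤ) : ℝ :=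
  if 0 ≤ a then Real.exp (-x) * x ^ a.toNat / (a.toNat.factorial : ℝ) else 0

theorem poissonWeight_natCast (x : ℝ) (m : ℕ) :
    poissonWeight x m = Real.exp (-x) * x ^ m / (m.factorial : ℝ) := by
  simp [poissonWeight]

theorem poissonWeight_of_neg (x : ℝ) {a : ℤ} (ha : a < 0) : poissonWeight x a = 0 := by
  simp [poissonWeight, not_le.2 ha]

theorem poissonWeight_zero (a : ℤ) : poissonWeight 0 a = if a = 0 then 1 else 0 := by
  rcases lt_or_ge a 0 with ha | ha
  · simp [poissonWeight_of_neg _ ha, ha.ne]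
  · lift a to ℕ using ha
    rw [poissonWeight_natCast]
    cases a <;> simp; omega

theorem hasSum_poissonWeight (x : ℝ) : HasSum (fun m : ℕ => poissonWeight x m) 1 := by
  simp only [poissonWeight_natCast]
  have := (NormedSpace.expSeries_div_hasSum_exp x).mul_left (Real.exp (-x))
  rw [← Real.exp_eq_exp_ℝ, ← Real.exp_add, neg_add_cancel, Real.exp_zero] at this
  simpa only [mul_div_assoc] using this

theorem poissonWeight_nonneg {x : ℝ} (hx : 0 ≤ x) (a : ℤ) : 0 ≤ poissonWeight x a := by
  unfold poissonWeight
  split_ifs <;> positivity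

theorem poissonWeight_le_one {x : ℝ} (hx : 0 ≤ x) (a : ℤ) : poissonWeight x a ≤ 1 := by
  rcases lt_or_ge a 0 with ha | ha
  · simp [poissonWeight_of_neg _ ha]
  · lift a to ℕ using ha
    exact le_hasSum (hasSum_poissonWeight x) a fun m _ => poissonWeight_nonneg hx m

theorem hasDerivAt_poissonWeight (x : ℝ) (a : ℤ) :
    HasDerivAt (fun y => poissonWeight y a) (poissonWeight x (a - 1) - poissonWeight x a) x := by
  rcases lt_or_ge a 0 with ha | ha
  · simp only [poissonWeight_of_neg _ ha, poissonWeight_of_neg _ (show a - 1 < 0 by omega),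
      sub_zero]
    exact hasDerivAt_const x 0
  · lift a to ℕ using ha
    simp only [poissonWeight_natCast]
    have h1 : HasDerivAt (fun y : ℝ => Real.exp (-y)) (-Real.exp (-x)) x := by
      simpa using (hasDerivAt_neg x).exp
    have h2 := (h1.mul (hasDerivAt_pow a x)).div_const (a.factorial : ℝ)
    convert! h2 using 1
    cases a with
    | zero => simp [poissonWeight_of_neg]
    | succ m =>
      have : ((m + 1 : ℕ) : ℤ) - 1 = (m : ℤ) := by push_cast; ring
      rw [this, poissonWeight_natCast, Nat.factorial_succ]
      have := Nat.factorial_ne_zero m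
      push_cast
      field_simp
      ring

theorem abs_deriv_poissonWeight_le {x : ℝ} (hx : 0 ≤ x) (a : ℤ) :
    |poissonWeight x (a - 1) - poissonWeight x a| ≤ 1 :=
  abs_sub_le_iff.2
    ⟨by linarith [poissonWeight_le_one hx (a - 1), poissonWeight_nonneg hx a],
      by linarith [poissonWeight_le_one hx a, poissonWeight_nonneg hx (a - 1)]⟩

theorem abs_poissonWeight_sub_le {x y : ℝ} (hx : 0 ≤ x) (hy : 0 ≤ y) (a : ℤ) :
    |poissonWeight x a - poissonWeight y a| ≤ |x - y| := by
  have := (convex_Ici (0 : ℝ)).norm_image_sub_le_of_norm_hasDerivWithin_le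
    (f := fun y => poissonWeight y a) (C := 1)
    (fun z _ => (hasDerivAt_poissonWeight z a).hasDerivWithinAt)
    (fun z hz => abs_deriv_poissonWeight_le hz a) (Set.mem_Ici.2 hy) (Set.mem_Ici.2 hx)
  simpa using this

/-- A Poisson variable plus an independent Bernoulli of mean `w` is compared with the Poisson
variable of the same total mean. As functions of `w` the two weights have equal derivatives at `0`,
and the derivative of the Poisson weight is `2`-Lipschitz, so the error is quadratic. -/
theorem abs_poissonWeight_add_sub_le {x w : ℝ} (hx : 0 ≤ x) (hw : 0 ≤ w) (a : ℤ) :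
    |(1 - w) * poissonWeight x a + w * poissonWeight x (a - 1) - poissonWeight (x + w) a| ≤
      2 * w ^ 2 := by
  have key := (convex_Icc (0 : ℝ) w).norm_image_sub_le_of_norm_hasDerivWithin_le
    (f := fun v => v * (poissonWeight x (a - 1) - poissonWeight x a) - poissonWeight (x + v) a)
    (f' := fun v => (poissonWeight x (a - 1) - poissonWeight x a) -
      (poissonWeight (x + v) (a - 1) - poissonWeight (x + v) a)) (C := 2 * w)
    (fun v _ => by
      have h1 := (hasDerivAt_id v).mul_const (poissonWeight x (a - 1) - poissonWeight x a)
      have h2 := (hasDerivAt_poissonWeight (x + v) a).comp_const_add x v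
      exact ((by simpa using h1 : HasDerivAt _ (poissonWeight x (a - 1) - poissonWeight x a) v).sub
        h2).hasDerivWithinAt)
    (fun v hv => by
      have h1 := abs_poissonWeight_sub_le hx (add_nonneg hx hv.1) (a - 1)
      have h2 := abs_poissonWeight_sub_le hx (add_nonneg hx hv.1) a
      have h3 : |x - (x + v)| ≤ w := by
        rw [sub_add_cancel_left, abs_neg, abs_of_nonneg hv.1]
        exact hv.2
      rw [Real.norm_eq_abs, abs_le]
      rw [abs_le] at h1 h2
      constructor <;> linarith)
    (Set.left_mem_Icc.2 hw) (Set.right_mem_Icc.2 hw)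
  simp only [Real.norm_eq_abs, sub_zero, add_zero, zero_mul, zero_sub, abs_of_nonneg hw] at key
  convert! key using 1
  · congr 1
    ring
  · ring

/-! ### Exponential moments of one round -/

/-- The expected number of the nodes `i ∈ I` which are picked `a i - c i` times, for Poisson
numbers of picks of means `x * W i`. -/
def potential {n : ℕ} (I : Finset (Fin n)) (a : Fin n → ℤ) (W : Fin n → ℝ) (x : ℝ)
    (c : Fin n → ℕ) : ℝ :=
  ∑ i ∈ I, poissonWeight (x * W i) (a i - c i)

section Potential

variable {n : ℕ} (I : Finset (Fin n)) (a : Fin n → ℤ) {W : Fin n → ℝ}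

theorem potential_add_single (x : ℝ) (c : Fin n → ℕ) (j : Fin n) :
    potential I a W x (c + Pi.single j 1) = potential I a W x c +
      if j ∈ I then poissonWeight (x * W j) (a j - c j - 1) - poissonWeight (x * W j) (a j - c j)
      else 0 := by
  rw [← sub_eq_iff_eq_add', potential, potential, ← Finset.sum_sub_distrib]
  have h : ∀ i ∈ I, poissonWeight (x * W i) (a i - ((c + Pi.single j 1 : Fin n → ℕ) i : ℕ)) -
      poissonWeight (x * W i) (a i - c i) =
      if i = j then poissonWeight (x * W j) (a j - c j - 1) - poissonWeight (x * W j) (a j - c j)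
      else 0 := by
    intro i _
    split_ifs with hij
    · subst hij
      simp [sub_sub]
    · simp [hij]
  rw [Finset.sum_congr rfl h, Finset.sum_ite_eq']

/-- Each Poisson weight is `1`-Lipschitz in its mean, and the means move by `|x - y| * W i`, which
sum to at most `|x - y|`. -/
theorem abs_potential_sub_le (hW : ∀ i, 0 ≤ W i) (hW1 : ∑ i, W i = 1) {x y : ℝ} (hx : 0 ≤ x)
    (hy : 0 ≤ y) (c : Fin n → ℕ) :
    |potential I a W x c - potential I a W y c| ≤ |x - y| := by
  rw [potential, potential, ← Finset.sum_sub_distrib]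
  calc |∑ i ∈ I, (poissonWeight (x * W i) (a i - c i) - poissonWeight (y * W i) (a i - c i))|
      ≤ ∑ i ∈ I, |x - y| * W i := by
        refine (Finset.abs_sum_le_sum_abs _ _).trans (Finset.sum_le_sum fun i _ => ?_)
        refine (abs_poissonWeight_sub_le (mul_nonneg hx (hW i)) (mul_nonneg hy (hW i)) _).trans ?_
        rw [← sub_mul, abs_mul, abs_of_nonneg (hW i)]
    _ ≤ ∑ i, |x - y| * W i := Finset.sum_le_sum_of_subset_of_nonneg (Finset.subset_univ _)
        fun i _ _ => mul_nonneg (abs_nonneg _) (hW i)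
    _ = |x - y| := by rw [← Finset.mul_sum, hW1, mul_one]

/-- Node `i` is hit with probability `W i`, so its term is exactly the Bernoulli against Poisson
comparison, with error `2 * W i ^ 2`. The sum is at most `2 * b` because the weights add up to `1`.
-/
theorem abs_potential_drift_le (hW : ∀ i, 0 ≤ W i) (hW1 : ∑ i, W i = 1) {b : ℝ}
    (hb : ∀ i, W i ≤ b) {x : ℝ} (hx : 0 ≤ x) (c : Fin n → ℕ) :
    |∑ j, W j * (potential I a W x (c + Pi.single j 1) - potential I a W (x + 1) c)| ≤
      2 * b := by
  have h1 : ∑ j, W j * (potential I a W x (c + Pi.single j 1) - potential I a W (x + 1) c) =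
      ∑ i ∈ I, ((1 - W i) * poissonWeight (x * W i) (a i - c i) +
        W i * poissonWeight (x * W i) (a i - c i - 1) -
          poissonWeight (x * W i + W i) (a i - c i)) := by
    simp only [potential_add_single, mul_sub, mul_add, Finset.sum_sub_distrib,
      Finset.sum_add_distrib, mul_ite, mul_zero, ← Finset.sum_mul, hW1, one_mul]
    rw [Finset.sum_ite_mem, Finset.univ_inter, potential, potential, ← Finset.sum_add_distrib,
      ← Finset.sum_sub_distrib, ← Finset.sum_add_distrib, ← Finset.sum_sub_distrib]
    refine Finset.sum_congr rfl fun i _ => ?_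
    rw [add_mul, one_mul]
    ring
  rw [h1]
  calc |_| ≤ ∑ i ∈ I, 2 * b * W i := by
        refine (Finset.abs_sum_le_sum_abs _ _).trans (Finset.sum_le_sum fun i _ => ?_)
        refine (abs_poissonWeight_add_sub_le (mul_nonneg hx (hW i)) (hW i) _).trans ?_
        nlinarith [hW i, hb i]
    _ ≤ ∑ i, 2 * b * W i := Finset.sum_le_sum_of_subset_of_nonneg (Finset.subset_univ _)
        fun i _ _ => mul_nonneg (by linarith [hW i, hb i]) (hW i)
    _ = 2 * b := by rw [← Finset.mul_sum, hW1, mul_one]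

/-- The near-supermartingale step. The increment is at most `2`, namely `1` from the pick and `1`
from the clock, so `exp y ≤ 1 + y + y ^ 2` produces `4 * θ ^ 2`; the drift bound produces `2 * |θ| *
b`. -/
theorem sum_mul_exp_potential_le (hW : ∀ i, 0 ≤ W i) (hW1 : ∑ i, W i = 1) {b : ℝ}
    (hb : ∀ i, W i ≤ b) {θ : ℝ} (hθ : |θ| ≤ 1 / 2) {x : ℝ} (hx : 0 ≤ x) (c : Fin n → ℕ) :
    ∑ j, W j * Real.exp (θ * potential I a W x (c + Pi.single j 1)) ≤
      Real.exp (4 * θ ^ 2 + 2 * |θ| * b) * Real.exp (θ * potential I a W (x + 1) c) := by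
  set D : Fin n → ℝ := fun j =>
    potential I a W x (c + Pi.single j 1) - potential I a W (x + 1) c with hD
  have hD2 : ∀ j, |D j| ≤ 2 := by
    intro j
    have h1 := abs_potential_sub_le I a hW hW1 hx (by linarith : 0 ≤ x + 1) c
    have h2 : |potential I a W x (c + Pi.single j 1) - potential I a W x c| ≤ 1 := by
      rw [potential_add_single, add_sub_cancel_left]
      split_ifs
      · exact abs_deriv_poissonWeight_le (mul_nonneg hx (hW j)) _
      · simp
    have h3 : |x - (x + 1)| = 1 := by simp
    rw [h3] at h1
    calc |D j| = |(potential I a W x (c + Pi.single j 1) - potential I a W x c) +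
          (potential I a W x c - potential I a W (x + 1) c)| := by rw [hD]; congr 1; ring
      _ ≤ 2 := (abs_add_le _ _).trans (by linarith)
  have hexp : ∀ j, Real.exp (θ * D j) ≤ 1 + θ * D j + 4 * θ ^ 2 := by
    intro j
    have h1 : |θ * D j| ≤ 1 := by
      rw [abs_mul]
      nlinarith [abs_nonneg θ, abs_nonneg (D j), hD2 j]
    have h2 := (abs_le.1 (Real.abs_exp_sub_one_sub_id_le h1)).2
    have h3 : (D j) ^ 2 ≤ 4 := by
      rw [← sq_abs]
      nlinarith [abs_nonneg (D j), hD2 j]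
    nlinarith [sq_nonneg θ, mul_le_mul_of_nonneg_left h3 (sq_nonneg θ)]
  calc ∑ j, W j * Real.exp (θ * potential I a W x (c + Pi.single j 1))
      = (∑ j, W j * Real.exp (θ * D j)) * Real.exp (θ * potential I a W (x + 1) c) := by
        rw [Finset.sum_mul]
        refine Finset.sum_congr rfl fun j _ => ?_
        rw [mul_assoc, ← Real.exp_add, hD]
        congr 2
        ring
    _ ≤ (∑ j, W j * (1 + θ * D j + 4 * θ ^ 2)) * Real.exp (θ * potential I a W (x + 1) c) := by
        gcongr with j
        · exact hW j
        · exact hexp j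
    _ = (1 + θ * (∑ j, W j * D j) + 4 * θ ^ 2) * Real.exp (θ * potential I a W (x + 1) c) := by
        congr 1
        simp only [mul_add, Finset.sum_add_distrib, ← Finset.sum_mul, hW1, one_mul, mul_one,
          Finset.mul_sum]
        congr 2
        exact Finset.sum_congr rfl fun j _ => by ring
    _ ≤ _ := by
        gcongr
        have h1 : θ * (∑ j, W j * D j) ≤ 2 * |θ| * b := by
          refine (le_abs_self _).trans ?_
          rw [abs_mul]
          have := mul_le_mul_of_nonneg_left (abs_potential_drift_le I a hW hW1 hb hx c)
            (abs_nonneg θ)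
          linarith
        linarith [Real.add_one_le_exp (4 * θ ^ 2 + 2 * |θ| * b)]

theorem iterate_pickOp_exp_potential_le {w : PMF (Fin n)}
    (hw : ∀ i, w i = ENNReal.ofReal (W i)) (hW : ∀ i, 0 ≤ W i) (hW1 : ∑ i, W i = 1) {b : ℝ}
    (hb : ∀ i, W i ≤ b) {θ : ℝ} (hθ : |θ| ≤ 1 / 2) (E : ℕ) (c : Fin n → ℕ) :
    (pickOp w)^[E] (fun c => ENNReal.ofReal (Real.exp (θ * potential I a W 0 c))) c ≤
      ENNReal.ofReal (Real.exp (4 * θ ^ 2 + 2 * |θ| * b) ^ E *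
        Real.exp (θ * potential I a W E c)) := by
  induction E generalizing c with
  | zero => simp
  | succ E ih =>
    rw [Function.iterate_succ_apply', pickOp]
    refine (expect_mono w fun j _ => ih _).trans ?_
    rw [expect, tsum_fintype]
    have : ∀ j, w j * ENNReal.ofReal (Real.exp (4 * θ ^ 2 + 2 * |θ| * b) ^ E *
        Real.exp (θ * potential I a W E (c + Pi.single j 1))) =
        ENNReal.ofReal (Real.exp (4 * θ ^ 2 + 2 * |θ| * b) ^ E *
          (W j * Real.exp (θ * potential I a W E (c + Pi.single j 1)))) := by
      intro j
      rw [hw, ← ENNReal.ofReal_mul (hW j)]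
      congr 1
      ring
    simp only [this]
    rw [← ENNReal.ofReal_sum_of_nonneg fun j _ => mul_nonneg (by positivity)
      (mul_nonneg (hW j) (Real.exp_pos _).le), ← Finset.mul_sum, pow_succ _ E,
      mul_assoc (_ ^ E)]
    push_cast
    refine ENNReal.ofReal_le_ofReal (mul_le_mul_of_nonneg_left ?_
      (pow_nonneg (Real.exp_pos _).le E))
    exact sum_mul_exp_potential_le I a hW hW1 hb hθ E.cast_nonneg c

end Potential

/-! ### Degree sequences and exponential moments of the number of edges in a round -/

theorem DegreeSequence.mean_eq (P : DegreeSequence) :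
    P.mean = ∑ k ∈ Finset.Ico 2 (P.maxDeg + 1), P.coeff k * k := by
  rw [DegreeSequence.mean, Polynomial.derivative_eval, Polynomial.sum_over_range _ (by simp)]
  simp only [one_pow, mul_one]
  symm
  refine Finset.sum_subset (fun k hk => ?_) fun k hk hk' => ?_
  · simp only [Finset.mem_Ico, maxDeg] at hk
    simpa using hk.2
  · simp only [Finset.mem_Ico, Finset.mem_range, maxDeg, not_and, not_lt] at hk hk'
    have : k = 0 ∨ k = 1 := by
      by_contra h
      have := hk' (by omega)
      omega
    rcases this with rfl | rfl
    · simp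
    · rw [show P.coeff 1 = 0 from P.coeff_one, zero_mul]

theorem DegreeSequence.sum_coeff (P : DegreeSequence) :
    ∑ k ∈ Finset.range (P.maxDeg + 1), P.coeff k = 1 := by
  have := P.eval_one
  rw [Polynomial.eval_eq_sum_range] at this
  simp only [one_pow, mul_one] at this
  exact this

theorem DegreeSequence.exists_coeff_pos (P : DegreeSequence) :
    ∃ k ∈ Finset.Ico 2 (P.maxDeg + 1), 0 < P.coeff k := by
  by_contra! h
  have h0 : ∀ k ∈ Finset.range (P.maxDeg + 1), P.coeff k = 0 := by
    intro k hk
    by_cases hk2 : 2 ≤ k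
    · exact le_antisymm (h k (by simp at hk ⊢; omega)) (P.coeff_nonneg k)
    · have : k = 0 ∨ k = 1 := by omega
      rcases this with rfl | rfl
      · exact P.coeff_zero
      · exact P.coeff_one
  have := P.sum_coeff
  rw [Finset.sum_eq_zero h0] at this
  exact zero_ne_one this

theorem DegreeSequence.mean_pos (P : DegreeSequence) : 0 < P.mean := by
  obtain ⟨k, hk, hpos⟩ := P.exists_coeff_pos
  rw [P.mean_eq]
  refine Finset.sum_pos' (fun i _ => mul_nonneg (P.coeff_nonneg i) i.cast_nonneg) ⟨k, hk, ?_⟩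
  have : 0 < k := by simp at hk; omega
  positivity

theorem DegreeSequence.two_le_maxDeg (P : DegreeSequence) : 2 ≤ P.maxDeg := by
  obtain ⟨k, hk, -⟩ := P.exists_coeff_pos
  simp at hk
  omega

theorem prod_map_ofReal_exp {ι : Type*} (l : List ι) (g : ι → ℝ) :
    (l.map fun k => ENNReal.ofReal (Real.exp (g k))).prod =
      ENNReal.ofReal (Real.exp (l.map g).sum) := by
  induction l with
  | nil => simp
  | cons k l ih =>
    simp only [List.map_cons, List.prod_cons, List.sum_cons, ih, Real.exp_add]
    rw [ENNReal.ofReal_mul (Real.exp_pos _).le]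

/-- The left side is the exponential moment of the number of edges in a round, a compound Poisson
variable. Its mean is `n * γ` because the means are normalized by `P.mean`, and `exp (k * u) - 1` is
linearized up to a quadratic error for `|k * u| ≤ 1`. -/
theorem prod_expect_poissonLaw_le (P : DegreeSequence) {γ : ℝ} (hγ : 0 < γ) (n : ℕ) {u : ℝ}
    (hu : P.maxDeg * |u| ≤ 1) :
    ((List.Ico 2 (P.maxDeg + 1)).map fun k =>
      expect (poissonLaw (n * γ * P.coeff k / P.mean)) fun m =>
        (ENNReal.ofReal (Real.exp u) ^ k) ^ m).prod ≤
      ENNReal.ofReal (Real.exp (n * γ * u + n * γ * P.maxDeg * u ^ 2)) := by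
  have hm := P.mean_pos
  have hr : ∀ k, 0 ≤ n * γ * P.coeff k / P.mean := fun k =>
    div_nonneg (mul_nonneg (by positivity) (P.coeff_nonneg k)) hm.le
  have h1 : ∀ k : ℕ, (expect (poissonLaw (n * γ * P.coeff k / P.mean)) fun m =>
      (ENNReal.ofReal (Real.exp u) ^ k) ^ m) =
      ENNReal.ofReal (Real.exp (n * γ * P.coeff k / P.mean * (Real.exp (k * u) - 1))) := by
    intro k
    rw [← expect_poissonLaw_pow (hr k) (Real.exp_pos _).le]
    congr 1
    funext m
    rw [Real.exp_nat_mul, ENNReal.ofReal_pow (by positivity), ENNReal.ofReal_pow (by positivity)]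
  simp only [h1]
  rw [prod_map_ofReal_exp]
  gcongr
  have h2 : ((List.Ico 2 (P.maxDeg + 1)).map fun k : ℕ =>
      n * γ * P.coeff k / P.mean * (Real.exp (k * u) - 1)).sum =
      ∑ k ∈ Finset.Ico 2 (P.maxDeg + 1),
        n * γ * P.coeff k / P.mean * (Real.exp (k * u) - 1) := rfl
  rw [h2]
  calc _ ≤ ∑ k ∈ Finset.Ico 2 (P.maxDeg + 1),
        (n * γ * u + n * γ * P.maxDeg * u ^ 2) / P.mean * (P.coeff k * k) := by
        refine Finset.sum_le_sum fun k hk => ?_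
        have hkL : (k : ℝ) ≤ P.maxDeg := by
          simp only [Finset.mem_Ico] at hk
          exact_mod_cast Nat.lt_succ_iff.1 hk.2
        have hku : |k * u| ≤ 1 := by
          rw [abs_mul, Nat.abs_cast]
          exact (mul_le_mul_of_nonneg_right hkL (abs_nonneg u)).trans hu
        have h3 := (abs_le.1 (Real.abs_exp_sub_one_sub_id_le hku)).2
        have h4 : Real.exp (k * u) - 1 ≤ k * (u + P.maxDeg * u ^ 2) := by
          have : (k * u) ^ 2 ≤ k * (P.maxDeg * u ^ 2) := by
            have := mul_le_mul_of_nonneg_right hkL (mul_nonneg k.cast_nonneg (sq_nonneg u))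
            nlinarith
          linarith
        refine (mul_le_mul_of_nonneg_left h4 (hr k)).trans (le_of_eq ?_)
        field_simp
    _ = _ := by
        rw [← Finset.mul_sum, ← P.mean_eq]
        field_simp

/-! ### Concentration in one round -/

theorem expect_roundChecks_exp_le {n : ℕ} (P : DegreeSequence) {γ : ℝ} (hγ : 0 < γ)
    (I : Finset (Fin n)) (a : Fin n → ℤ) {W : Fin n → ℝ} {w : PMF (Fin n)}
    (hw : ∀ i, w i = ENNReal.ofReal (W i)) (hW : ∀ i, 0 ≤ W i) (hW1 : ∑ i, W i = 1) {b : ℝ}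
    (hb : ∀ i, W i ≤ b) (hb0 : 0 ≤ b) (hb1 : b ≤ 1) {θ : ℝ} (hθ : 4 * P.maxDeg * |θ| ≤ 1)
    (t : ℕ) :
    expect (roundChecks P γ w t)
      (fun C => ENNReal.ofReal (Real.exp (θ * potential I a W 0 (varDegree C)))) ≤
      ENNReal.ofReal (2 * Real.exp (θ * potential I a W (n * γ) 0 +
        (n * γ * (4 * θ ^ 2 + 2 * |θ| * b) + n * γ * P.maxDeg * (16 * θ ^ 2)))) := by
  have hL : (2 : ℝ) ≤ P.maxDeg := by exact_mod_cast P.two_le_maxDeg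
  have hθ8 : |θ| ≤ 1 / 8 := by nlinarith [abs_nonneg θ]
  set h : ℝ := 4 * θ ^ 2 + 2 * |θ| * b with hh
  set ν : ℝ := n * γ with hν
  have hν0 : 0 ≤ ν := by positivity
  set Φ : ℝ := potential I a W ν 0 with hΦ
  have hh0 : 0 ≤ h := by positivity
  have hh3 : h ≤ 3 * |θ| := by
    have h1 : θ ^ 2 = |θ| * |θ| := by rw [← sq_abs]; ring
    have h2 := mul_le_mul_of_nonneg_left hb1 (abs_nonneg θ)
    nlinarith [abs_nonneg θ]
  -- `exp (|θ| * |E - ν|)` is bounded by the sum of the exponentials for the two signs of `E - ν`,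
  -- which makes the bound a sum of two geometric functions of `E`.
  have hbase : ∀ E, (pickOp w)^[E]
      (fun c => ENNReal.ofReal (Real.exp (θ * potential I a W 0 c))) 0 ≤
      ENNReal.ofReal (Real.exp (θ * Φ - |θ| * ν)) * ENNReal.ofReal (Real.exp (h + |θ|)) ^ E +
      ENNReal.ofReal (Real.exp (θ * Φ + |θ| * ν)) * ENNReal.ofReal (Real.exp (h - |θ|)) ^ E := by
    intro E
    refine (iterate_pickOp_exp_potential_le I a hw hW hW1 hb (by linarith) E 0).trans ?_
    rw [← ENNReal.ofReal_pow (Real.exp_pos _).le, ← ENNReal.ofReal_pow (Real.exp_pos _).le,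
      ← ENNReal.ofReal_mul (Real.exp_pos _).le, ← ENNReal.ofReal_mul (Real.exp_pos _).le,
      ← ENNReal.ofReal_add (by positivity) (by positivity)]
    refine ENNReal.ofReal_le_ofReal ?_
    simp only [← Real.exp_nat_mul, ← Real.exp_add]
    have h1 : θ * potential I a W E 0 ≤ θ * Φ + |θ| * |E - ν| := by
      have := abs_potential_sub_le I a hW hW1 E.cast_nonneg hν0 0
      have h2 := mul_le_mul_of_nonneg_left this (abs_nonneg θ)
      rw [← abs_mul, mul_sub] at h2
      linarith [le_abs_self (θ * potential I a W E 0 - θ * potential I a W ν 0)]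
    rcases abs_cases ((E : ℝ) - ν) with ⟨h3, -⟩ | ⟨h3, -⟩
    · refine le_add_of_le_of_nonneg (Real.exp_le_exp.2 ?_) (Real.exp_pos _).le
      rw [h3] at h1
      linarith
    · refine le_add_of_nonneg_of_le (Real.exp_pos _).le (Real.exp_le_exp.2 ?_)
      rw [h3] at h1
      linarith
  have hround := expect_draws_le P γ w t _ 0 hbase (List.Ico 2 (P.maxDeg + 1)) 0
  rw [roundChecks, expect_map]
  simp only [Function.iterate_zero, id_eq, zero_add, pow_zero, one_mul] at hround
  refine hround.trans ?_
  -- The rates needed are `h ± |θ|`, of size at most `4 * |θ|`; this is where `4 * P.maxDeg * |θ| ≤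
  -- 1` is used. The contributions `± |θ| * ν` later cancel those in the prefactors of `hbase`.
  have hprod : ∀ u, |u| ≤ 4 * |θ| →
      ((List.Ico 2 (P.maxDeg + 1)).map fun k =>
        expect (poissonLaw (n * γ * P.coeff k / P.mean)) fun m =>
          (ENNReal.ofReal (Real.exp u) ^ k) ^ m).prod ≤
      ENNReal.ofReal (Real.exp (ν * u + ν * P.maxDeg * (16 * θ ^ 2))) := by
    intro u hu
    refine (prod_expect_poissonLaw_le P hγ n (u := u) (by nlinarith)).trans ?_
    have : u ^ 2 ≤ 16 * θ ^ 2 := by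
      rw [← sq_abs u, ← sq_abs θ]
      nlinarith [abs_nonneg u]
    gcongr
  have hu1 : abs (h + |θ|) ≤ 4 * |θ| := by
    rw [abs_le]
    constructor <;> linarith [abs_nonneg θ]
  have hu2 : abs (h - |θ|) ≤ 4 * |θ| := by
    rw [abs_le]
    constructor <;> linarith [abs_nonneg θ]
  refine (add_le_add (mul_le_mul_right (hprod _ hu1) _)
    (mul_le_mul_right (hprod _ hu2) _)).trans ?_
  rw [← ENNReal.ofReal_mul (Real.exp_pos _).le, ← ENNReal.ofReal_mul (Real.exp_pos _).le,
    ← ENNReal.ofReal_add (by positivity) (by positivity), ← Real.exp_add, ← Real.exp_add]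
  refine ENNReal.ofReal_le_ofReal (le_of_eq ?_)
  rw [two_mul]
  congr 2 <;> ring

/-- In one round, the number of the nodes `i ∈ I` which are picked `a i` times is exponentially
concentrated around its value for independent Poisson numbers of picks. -/
theorem exists_roundChecks_concentration (P : DegreeSequence) {γ : ℝ} (hγ : 0 < γ) {D : ℝ}
    (hD : 0 ≤ D) :
    ∃ A B : ℝ, 0 < A ∧ 0 < B ∧ ∀ (n : ℕ) (I : Finset (Fin n)) (a : Fin n → ℤ) (W : Fin n → ℝ)
      (w : PMF (Fin n)), (∀ i, w i = ENNReal.ofReal (W i)) → (∀ i, 0 ≤ W i) → ∑ i, W i = 1 →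
      (∀ i, n * W i ≤ D) → ∀ (t : ℕ) (ε : ℝ), 0 < ε → ε ≤ 1 →
      prob (roundChecks P γ w t) {C | n * ε ≤ |potential I a W 0 (varDegree C) -
        potential I a W (n * γ) 0|} ≤ ENNReal.ofReal (A * Real.exp (-B * n * ε ^ 2)) := by
  have hL : (2 : ℝ) ≤ P.maxDeg := by exact_mod_cast P.two_le_maxDeg
  set L : ℝ := (P.maxDeg : ℝ) with hLdef
  set C₁ : ℝ := γ * (4 + 16 * L) with hC₁
  have hC₁0 : 0 < C₁ := by positivity
  -- Chernoff's parameter will be `θ = ± β * ε`. The term `4 * L` keeps `θ` in the admissible range,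
  -- and `2 * C₁` makes the quadratic cost `n * C₁ * θ ^ 2` at most half of the gain `n * β * ε ^
  -- 2`. The total drift stays bounded because `n * b ≤ D`, and goes into the prefactor.
  set β : ℝ := 1 / (4 * L + 2 * C₁) with hβ
  have hβ0 : 0 < β := by positivity
  have hβL : 4 * L * β ≤ 1 := by
    rw [hβ, mul_one_div, div_le_one (by positivity)]
    linarith
  have hβC : C₁ * β ≤ 1 / 2 := by
    rw [hβ, mul_one_div, div_le_iff₀ (by positivity)]
    linarith
  refine ⟨4 * Real.exp (2 * γ * β * D), β / 2, by positivity, by positivity, ?_⟩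
  intro n I a W w hw hW hW1 hWD t ε hε hε1
  have hn : (0 : ℝ) < n := by
    rcases Nat.eq_zero_or_pos n with rfl | hn
    · simp at hW1
    · exact_mod_cast hn
  set b : ℝ := min 1 (D / n) with hb
  have hWb : ∀ i, W i ≤ b := fun i => le_min
    (hW1 ▸ Finset.single_le_sum (fun i _ => hW i) (Finset.mem_univ i))
    (by rw [le_div_iff₀ hn, mul_comm]; exact hWD i)
  have hb0 : 0 ≤ b := le_min zero_le_one (by positivity)
  have hnb : n * b ≤ D := by
    have := min_le_right 1 (D / n)
    rw [le_div_iff₀ hn] at this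
    linarith
  set Φ : ℝ := potential I a W (n * γ) 0 with hΦ
  have key : ∀ θ : ℝ, |θ| = β * ε →
      expect (roundChecks P γ w t) (fun C =>
        ENNReal.ofReal (Real.exp (-(θ * Φ) - n * (β * ε ^ 2))) *
          ENNReal.ofReal (Real.exp (θ * potential I a W 0 (varDegree C)))) ≤
      ENNReal.ofReal (2 * Real.exp (2 * γ * β * D) * Real.exp (-(β / 2) * n * ε ^ 2)) := by
    intro θ hθ
    have hθ1 : 4 * P.maxDeg * |θ| ≤ 1 := by
      rw [hθ, ← hLdef]
      nlinarith [mul_nonneg (by positivity : 0 ≤ 4 * L * β) (sub_nonneg.2 hε1)]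
    rw [expect_const_mul]
    refine (mul_le_mul_right (expect_roundChecks_exp_le P hγ I a hw hW hW1 hWb hb0
      (min_le_left _ _) hθ1 t) _).trans ?_
    rw [← ENNReal.ofReal_mul (Real.exp_pos _).le, mul_left_comm, ← Real.exp_add, mul_assoc 2 (Real.exp _),
      ← Real.exp_add]
    refine ENNReal.ofReal_le_ofReal (mul_le_mul_of_nonneg_left (Real.exp_le_exp.2 ?_)
      zero_le_two)
    rw [← hLdef, ← sq_abs θ, hθ]
    have h1 : n * γ * (2 * (β * ε) * b) ≤ 2 * γ * β * D := by
      have h2 : n * b * ε ≤ D := by nlinarith [mul_nonneg hn.le hb0]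
      nlinarith [mul_le_mul_of_nonneg_left h2 (by positivity : 0 ≤ 2 * γ * β)]
    have h3 : n * β * ε ^ 2 * (C₁ * β) ≤ n * β * ε ^ 2 * (1 / 2) := by gcongr
    rw [hC₁] at h3
    linarith
  have hsplit : ∀ C ∈ (roundChecks P γ w t).support,
      Set.indicator {C | n * ε ≤ |potential I a W 0 (varDegree C) - Φ|} 1 C ≤
      ENNReal.ofReal (Real.exp (-((β * ε) * Φ) - n * (β * ε ^ 2))) *
          ENNReal.ofReal (Real.exp ((β * ε) * potential I a W 0 (varDegree C))) +
      ENNReal.ofReal (Real.exp (-((-(β * ε)) * Φ) - n * (β * ε ^ 2))) *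
          ENNReal.ofReal (Real.exp ((-(β * ε)) * potential I a W 0 (varDegree C))) := by
    classical
    intro C _
    rw [Set.indicator_apply]
    split_ifs with hC
    · change n * ε ≤ |potential I a W 0 (varDegree C) - Φ| at hC
      simp only [← ENNReal.ofReal_mul (Real.exp_pos _).le, ← Real.exp_add, Pi.one_apply]
      rcases le_abs.1 hC with h | h
      · refine le_add_right ?_
        rw [ENNReal.one_le_ofReal, Real.one_le_exp_iff]
        nlinarith [mul_le_mul_of_nonneg_left h (by positivity : 0 ≤ β * ε)]
      · refine le_add_left ?_
        rw [ENNReal.one_le_ofReal, Real.one_le_exp_iff]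
        nlinarith [mul_le_mul_of_nonneg_left h (by positivity : 0 ≤ β * ε)]
    · exact zero_le
  refine (expect_mono _ hsplit).trans ?_
  rw [expect_add]
  refine (add_le_add (key _ (abs_of_pos (by positivity)))
    (key _ (by rw [abs_neg, abs_of_pos (by positivity)]))).trans ?_
  rw [← ENNReal.ofReal_add (by positivity) (by positivity)]
  refine ENNReal.ofReal_le_ofReal (le_of_eq ?_)
  ring

/-! ### The limit distributions -/

theorem DegreeSequence.zero_le_coeff (P : DegreeSequence) (k : ℕ) : 0 ≤ P.coeff k :=
  P.coeff_nonneg k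

theorem DegreeSequence.coeff_le_one (P : DegreeSequence) {k : ℕ} (hk : k ≤ P.maxDeg) :
    P.coeff k ≤ 1 := by
  rw [← P.sum_coeff]
  exact Finset.single_le_sum (f := P.coeff) (fun i _ => P.coeff_nonneg i)
    (Finset.mem_range.2 (Nat.lt_succ_of_le hk))

theorem tsum_ofReal_poissonWeight {x : ℝ} (hx : 0 ≤ x) :
    ∑' a : ℤ, ENNReal.ofReal (poissonWeight x a) = 1 := by
  have hsupp : Function.support (fun a : ℤ => ENNReal.ofReal (poissonWeight x a)) ⊆
      Set.range ((↑) : ℕ → ℤ) := by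
    intro a ha
    by_contra h
    refine ha ?_
    have : a < 0 := by
      by_contra h0
      exact h ⟨a.toNat, Int.toNat_of_nonneg (not_lt.1 h0)⟩
    simp [poissonWeight_of_neg _ this]
  rw [← Nat.cast_injective.tsum_eq hsupp,
    ← ENNReal.ofReal_tsum_of_nonneg (f := fun m : ℕ => poissonWeight x m)
      (fun m => poissonWeight_nonneg hx m)
      (hasSum_poissonWeight x).summable, (hasSum_poissonWeight x).tsum_eq, ENNReal.ofReal_one]

section Limit

variable (Λ : DegreeSequence) (γ : ℝ)

/-- The limit `∑_{l, d} Ω^(t)_{l, d} [d]_+` of the normalized number of free sockets. -/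
def freeMass (t : ℕ) : ℝ :=
  ∑ l ∈ Finset.range (Λ.maxDeg + 1), ∑ d ∈ Finset.Icc (0 : ℤ) Λ.maxDeg,
    omega Λ γ t l d * (d.toNat : ℝ)

theorem kernelMean_eq (t : ℕ) (d : ℤ) :
    kernelMean Λ.maxDeg γ (omega Λ γ t) d = γ * (d.toNat : ℝ) / freeMass Λ γ t := rfl

theorem omega_succ (t l : ℕ) (d : ℤ) :
    omega Λ γ (t + 1) l d = ∑ d' ∈ Finset.Icc d (Λ.maxDeg : ℤ),
      omega Λ γ t l d' * poissonWeight (γ * (d'.toNat : ℝ) / freeMass Λ γ t) (d' - d) := by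
  rw [omega]
  refine Finset.sum_congr rfl fun d' hd' => ?_
  rw [kernel, kernelMean_eq, poissonWeight, if_pos (sub_nonneg.2 (Finset.mem_Icc.1 hd').1)]

variable {γ}

theorem freeMass_nonneg_of {t : ℕ} (h : ∀ l d, 0 ≤ omega Λ γ t l d) : 0 ≤ freeMass Λ γ t :=
  Finset.sum_nonneg fun l _ => Finset.sum_nonneg fun d _ => mul_nonneg (h l d) (Nat.cast_nonneg _)

theorem omega_nonneg (hγ : 0 < γ) (t l : ℕ) (d : ℤ) : 0 ≤ omega Λ γ t l d := by
  induction t generalizing l d with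
  | zero =>
    simp only [omega]
    split_ifs
    exacts [Λ.coeff_nonneg l, le_rfl]
  | succ t ih =>
    rw [omega_succ]
    have := freeMass_nonneg_of Λ ih
    exact Finset.sum_nonneg fun d' _ => mul_nonneg (ih l d')
      (poissonWeight_nonneg (by positivity) _)

theorem freeMass_nonneg (hγ : 0 < γ) (t : ℕ) : 0 ≤ freeMass Λ γ t :=
  freeMass_nonneg_of Λ (omega_nonneg Λ hγ t)

theorem omega_eq_zero (t l : ℕ) {d : ℤ} (hd : l < d) : omega Λ γ t l d = 0 := by
  induction t generalizing d with
  | zero => simp only [omega, if_neg hd.ne']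
  | succ t ih =>
    rw [omega_succ]
    refine Finset.sum_eq_zero fun d' hd' => ?_
    rw [ih (hd.trans_le (Finset.mem_Icc.1 hd').1), zero_mul]

theorem omega_self_pos (hγ : 0 < γ) (t : ℕ) {l : ℕ} (hl : l ≤ Λ.maxDeg) (hΛ : 0 < Λ.coeff l) :
    0 < omega Λ γ t l l := by
  induction t with
  | zero => simpa [omega] using hΛ
  | succ t ih =>
    rw [omega_succ]
    have h0 := freeMass_nonneg Λ hγ t
    refine Finset.sum_pos' (fun d' _ => mul_nonneg (omega_nonneg Λ hγ t l d')
      (poissonWeight_nonneg (by positivity) _)) ⟨l, ?_, mul_pos ih ?_⟩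
    · rw [Finset.mem_Icc]
      exact ⟨le_rfl, by exact_mod_cast hl⟩
    · rw [sub_self]
      have := poissonWeight_natCast (γ * (((l : ℤ).toNat : ℕ) : ℝ) / freeMass Λ γ t) 0
      rw [Nat.cast_zero] at this
      rw [this]
      positivity

/-- Some class `l ≥ 2` has positive mass, and in every round a positive fraction of its untouched
nodes, of order `exp (-λ)`, is not picked. -/
theorem freeMass_pos (hγ : 0 < γ) (t : ℕ) : 0 < freeMass Λ γ t := by
  obtain ⟨l, hl, hΛ⟩ := Λ.exists_coeff_pos
  rw [Finset.mem_Ico, Nat.lt_succ_iff] at hl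
  have h0 : ∀ k, ∀ d ∈ Finset.Icc (0 : ℤ) Λ.maxDeg, 0 ≤ omega Λ γ t k d * (d.toNat : ℝ) :=
    fun k d _ => mul_nonneg (omega_nonneg Λ hγ t k d) (Nat.cast_nonneg _)
  refine Finset.sum_pos' (fun k _ => Finset.sum_nonneg (h0 k))
    ⟨l, Finset.mem_range.2 (by omega), Finset.sum_pos' (h0 l) ⟨l, ?_, ?_⟩⟩
  · rw [Finset.mem_Icc]
    exact ⟨by positivity, by exact_mod_cast hl.2⟩
  · refine mul_pos (omega_self_pos Λ hγ t hl.2 hΛ) ?_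
    rw [Int.toNat_natCast]
    have : 0 < l := by omega
    exact_mod_cast this

/-- Nodes never change class, and each Poisson kernel is a probability law on the number of sockets
lost. This conservation makes the limit profile a probability law. -/
theorem tsum_ofReal_omega (hγ : 0 < γ) (t : ℕ) {l : ℕ} (hl : l ≤ Λ.maxDeg) :
    ∑' d : ℤ, ENNReal.ofReal (omega Λ γ t l d) = ENNReal.ofReal (Λ.coeff l) := by
  induction t with
  | zero =>
    rw [tsum_eq_single (l : ℤ)]
    · simp [omega]
    · intro d hd
      simp [omega, hd]
  | succ t ih =>
    have h0 : ∀ d' : ℤ, 0 ≤ γ * (d'.toNat : ℝ) / freeMass Λ γ t := fun d' => by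
      have := freeMass_nonneg Λ hγ t
      positivity
    -- The truncated sum equals the sum over all integers: below `d` the Poisson weight vanishes,
    -- above `Λ.maxDeg` the mass does. Tonelli then applies.
    have h1 : ∀ d : ℤ, ENNReal.ofReal (omega Λ γ (t + 1) l d) =
        ∑' d' : ℤ, ENNReal.ofReal (omega Λ γ t l d') *
          ENNReal.ofReal (poissonWeight (γ * (d'.toNat : ℝ) / freeMass Λ γ t) (d' - d)) := by
      intro d
      rw [omega_succ, ENNReal.ofReal_sum_of_nonneg fun d' _ => mul_nonneg
        (omega_nonneg Λ hγ t l d') (poissonWeight_nonneg (h0 d') _)]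
      rw [tsum_eq_sum (s := Finset.Icc d (Λ.maxDeg : ℤ))]
      · exact Finset.sum_congr rfl fun d' _ => ENNReal.ofReal_mul (omega_nonneg Λ hγ t l d')
      · intro d' hd'
        rw [Finset.mem_Icc, not_and_or, not_le, not_le] at hd'
        rcases hd' with h | h
        · rw [poissonWeight_of_neg _ (by omega), ENNReal.ofReal_zero, mul_zero]
        · rw [omega_eq_zero Λ t l (by omega), ENNReal.ofReal_zero, zero_mul]
    simp only [h1]
    rw [ENNReal.tsum_comm, ← ih]
    refine tsum_congr fun d' => ?_
    have h2 := (Equiv.subLeft d').tsum_eq fun a => ENNReal.ofReal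
      (poissonWeight (γ * (d'.toNat : ℝ) / freeMass Λ γ t) a)
    simp only [Equiv.subLeft_apply] at h2
    rw [ENNReal.tsum_mul_left, h2, tsum_ofReal_poissonWeight (h0 d'), mul_one]

theorem omega_le_one (hγ : 0 < γ) (t : ℕ) {l : ℕ} (hl : l ≤ Λ.maxDeg) (d : ℤ) :
    omega Λ γ t l d ≤ 1 := by
  have h : ENNReal.ofReal (omega Λ γ t l d) ≤ ENNReal.ofReal (Λ.coeff l) := by
    rw [← tsum_ofReal_omega Λ hγ t hl]
    exact ENNReal.le_tsum (f := fun d => ENNReal.ofReal (omega Λ γ t l d)) d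
  rw [ENNReal.ofReal_le_ofReal_iff (Λ.zero_le_coeff l)] at h
  exact h.trans (Λ.coeff_le_one hl)

theorem limitProfile_nonneg (hγ : 0 < γ) (l : ℕ) : 0 ≤ limitProfile Λ γ l :=
  Finset.sum_nonneg fun _ _ => omega_nonneg Λ hγ _ _ _

theorem tsum_ofReal_limitProfile (hγ : 0 < γ) :
    ∑' l, ENNReal.ofReal (limitProfile Λ γ l) = 1 := by
  simp only [limitProfile, ENNReal.ofReal_sum_of_nonneg fun _ _ => omega_nonneg Λ hγ _ _ _]
  rw [Summable.tsum_finsetSum fun _ _ => ENNReal.summable]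
  have h1 : ∀ l' ∈ Finset.range (Λ.maxDeg + 1),
      ∑' l : ℕ, ENNReal.ofReal (omega Λ γ (numRounds Λ γ) l' ((l' : ℤ) - l)) =
      ENNReal.ofReal (Λ.coeff l') := by
    intro l' hl'
    rw [← tsum_ofReal_omega Λ hγ (numRounds Λ γ) (Nat.lt_succ_iff.1 (Finset.mem_range.1 hl'))]
    have hinj : Function.Injective fun l : ℕ => (l' : ℤ) - l := fun x y h => by simpa using h
    refine hinj.tsum_eq (f := fun d => ENNReal.ofReal (omega Λ γ (numRounds Λ γ) l' d)) ?_
    intro d hd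
    by_contra h
    refine hd ?_
    have : (l' : ℤ) < d := by
      by_contra h0
      exact h ⟨((l' : ℤ) - d).toNat, by simp only; omega⟩
    simp [omega_eq_zero Λ _ _ this]
  rw [Finset.sum_congr rfl h1, ← ENNReal.ofReal_sum_of_nonneg fun i _ => Λ.zero_le_coeff i]
  rw [show (∑ i ∈ Finset.range (Λ.maxDeg + 1), Λ.coeff i) = 1 from Λ.sum_coeff,
    ENNReal.ofReal_one]

theorem limitProfile_le_one (hγ : 0 < γ) (l : ℕ) : limitProfile Λ γ l ≤ 1 := by
  rw [← ENNReal.ofReal_le_one, ← tsum_ofReal_limitProfile Λ hγ]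
  exact ENNReal.le_tsum (f := fun l => ENNReal.ofReal (limitProfile Λ γ l)) l

theorem hasSum_limitProfile (hγ : 0 < γ) : HasSum (limitProfile Λ γ) 1 := by
  have h := tsum_ofReal_limitProfile Λ hγ
  have hs : Summable (limitProfile Λ γ) := by
    have := ENNReal.summable_toReal (f := fun l => ENNReal.ofReal (limitProfile Λ γ l))
      (by rw [h]; exact ENNReal.one_ne_top)
    simpa only [ENNReal.toReal_ofReal (limitProfile_nonneg Λ hγ _)] using this
  rw [← ENNReal.ofReal_tsum_of_nonneg (limitProfile_nonneg Λ hγ) hs, ENNReal.ofReal_eq_one] at h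
  rw [← h]
  exact hs.hasSum

end Limit

/-! ### The profile of a state -/

/-- The class of a variable node, recovered from its numbers of free and of used sockets. -/
def nodeClass {n : ℕ} (s : State n) (i : Fin n) : ℤ := s.free i + varDegree s.graph i

/-- The fraction of the variable nodes in class `l` which have `d` free sockets. -/
def stateProfile {n : ℕ} (s : State n) (l : ℕ) (d : ℤ) : ℝ :=
  ((Finset.univ.filter fun i => nodeClass s i = l ∧ s.free i = d).card : ℝ) / n

/-- All the classes of the nodes are between `0` and `L`. -/
def ClassesLE {n : ℕ} (L : ℕ) (s : State n) : Prop :=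
  ∀ i, 0 ≤ nodeClass s i ∧ nodeClass s i ≤ L

/-- The class of nodes with label `l`. -/
def classNodes {n : ℕ} (s : State n) (l : ℕ) : Finset (Fin n) :=
  Finset.univ.filter fun i => nodeClass s i = l

/-- Every socket used moves one unit from `free` to the degree. The class is therefore invariant
under any added checks, including those of the failure rule. -/
theorem nodeClass_add {n : ℕ} (s : State n) (C : List (CheckNode n)) :
    nodeClass (s.add C) = nodeClass s := by
  funext i
  simp only [nodeClass, State.add, varDegree_append]
  push_cast
  ring

theorem ClassesLE.free_le {n L : ℕ} {s : State n} (hs : ClassesLE L s) (i : Fin n) :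
    s.free i ≤ L := by
  have := (hs i).2
  unfold nodeClass at this
  omega

theorem classesLE_of_mem_support {Λ P : DegreeSequence} {γ : ℝ} {n : Blocklength Λ}
    {F : FailureRule n.1} {t : ℕ} {s : State n.1} (hs : s ∈ (stateLaw Λ P γ n F t).support) :
    ClassesLE Λ.maxDeg s := by
  induction t generalizing s with
  | zero =>
    rw [stateLaw, initialLaw, PMF.mem_support_map_iff] at hs
    obtain ⟨f, -, rfl⟩ := hs
    intro i
    simp only [nodeClass, varDegree_nil, Nat.cast_zero, add_zero]
    exact ⟨by positivity, by exact_mod_cast Nat.lt_succ_iff.1 (f i).2⟩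
  | succ t ih =>
    rw [stateLaw, PMF.mem_support_bind_iff] at hs
    obtain ⟨s', hs', h⟩ := hs
    rw [step, PMF.mem_support_map_iff] at h
    obtain ⟨C, -, rfl⟩ := h
    intro i
    rw [nodeClass_add]
    exact ih hs' i

theorem stateProfile_nonneg {n : ℕ} (s : State n) (l : ℕ) (d : ℤ) : 0 ≤ stateProfile s l d := by
  unfold stateProfile
  positivity

theorem sum_stateProfile_le_one {n : ℕ} (s : State n) (l : ℕ) (D : Finset ℤ) :
    ∑ d ∈ D, stateProfile s l d ≤ 1 := by
  unfold stateProfile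
  rw [← Finset.sum_div]
  refine div_le_one_of_le₀ ?_ n.cast_nonneg
  have h : (∑ d ∈ D, (Finset.univ.filter fun i => nodeClass s i = l ∧ s.free i = d).card) ≤
      n := by
    rw [← Finset.card_biUnion]
    · exact (Finset.card_le_univ _).trans (Fintype.card_fin n).le
    · intro x _ y _ hxy
      rw [Function.onFun, Finset.disjoint_left]
      intro i hi hi'
      rw [Finset.mem_filter] at hi hi'
      exact hxy (hi.2.2.symm.trans hi'.2.2)
  exact_mod_cast h

theorem stateProfile_le_one {n : ℕ} (s : State n) (l : ℕ) (d : ℤ) : stateProfile s l d ≤ 1 := by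
  simpa using sum_stateProfile_le_one s l {d}

theorem mul_stateProfile {n : ℕ} (hn : 0 < n) (s : State n) (l : ℕ) (d : ℤ) :
    n * stateProfile s l d = ∑ i ∈ classNodes s l, if s.free i = d then 1 else 0 := by
  have : (n : ℝ) ≠ 0 := by exact_mod_cast hn.ne'
  rw [stateProfile, mul_div_cancel₀ _ this, Finset.sum_boole, classNodes, Finset.filter_filter]

/-- At clock `0` the Poisson weights are indicators, so the potential is a true count, whatever `W`
is. -/
theorem mul_stateProfile_add {n : ℕ} (hn : 0 < n) (s : State n) (C : List (CheckNode n)) (l : ℕ)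
    (d : ℤ) (W : Fin n → ℝ) :
    n * stateProfile (s.add C) l d =
      potential (classNodes s l) (fun i => s.free i - d) W 0 (varDegree C) := by
  rw [mul_stateProfile hn, potential, classNodes, classNodes, nodeClass_add]
  refine Finset.sum_congr rfl fun i _ => ?_
  rw [zero_mul, poissonWeight_zero]
  refine if_congr ?_ rfl rfl
  simp only [State.add]
  omega

theorem sum_mul_stateProfile {n : ℕ} (hn : 0 < n) (s : State n) (l : ℕ) (D : Finset ℤ)
    (g : ℤ → ℝ) :
    n * ∑ d ∈ D, stateProfile s l d * g d =
      ∑ i ∈ classNodes s l, if s.free i ∈ D then g (s.free i) else 0 := by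
  rw [Finset.mul_sum]
  simp only [← mul_assoc, mul_stateProfile hn, Finset.sum_mul, ite_mul, one_mul, zero_mul]
  rw [Finset.sum_comm]
  exact Finset.sum_congr rfl fun i _ => by rw [Finset.sum_ite_eq]

theorem potential_eq_sum_stateProfile {n L : ℕ} (hn : 0 < n) {s : State n} (hs : ClassesLE L s)
    (x : ℝ) (l : ℕ) (d : ℤ) :
    potential (classNodes s l) (fun i => s.free i - d)
      (fun i => ((s.free i).toNat : ℝ) / totalFree s.free) x 0 =
      n * ∑ d' ∈ Finset.Icc d (L : ℤ), stateProfile s l d' *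
        poissonWeight (x * ((d'.toNat : ℝ) / totalFree s.free)) (d' - d) := by
  rw [sum_mul_stateProfile hn s l _ fun d' =>
    poissonWeight (x * ((d'.toNat : ℝ) / totalFree s.free)) (d' - d), potential]
  refine Finset.sum_congr rfl fun i _ => ?_
  simp only [Pi.zero_apply, Nat.cast_zero, sub_zero]
  split_ifs with h
  · rfl
  · have := hs.free_le i
    rw [Finset.mem_Icc] at h
    exact poissonWeight_of_neg _ (by omega)

theorem totalFree_eq_sum_stateProfile {n L : ℕ} (hn : 0 < n) {s : State n}
    (hs : ClassesLE L s) :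
    (totalFree s.free : ℝ) = n * ∑ l ∈ Finset.range (L + 1), ∑ d ∈ Finset.Icc (0 : ℤ) L,
      stateProfile s l d * (d.toNat : ℝ) := by
  rw [Finset.mul_sum]
  simp only [sum_mul_stateProfile hn s _ _ fun d => (d.toNat : ℝ)]
  simp only [classNodes, Finset.sum_filter]
  rw [Finset.sum_comm, totalFree]
  push_cast
  refine Finset.sum_congr rfl fun i _ => ?_
  rw [Finset.sum_eq_single (nodeClass s i).toNat]
  · rw [if_pos (Int.toNat_of_nonneg (hs i).1).symm]
    have := hs.free_le i
    split_ifs with h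
    · rfl
    · rw [Finset.mem_Icc] at h
      rw [Int.toNat_of_nonpos (by omega), Nat.cast_zero]
  · intro l _ hl
    rw [if_neg]
    intro h
    exact hl (by omega)
  · intro h
    have := hs i
    simp only [Finset.mem_range, not_lt] at h
    omega

theorem nodeLaw_apply {n : ℕ} (d : Fin n → ℤ) (h : totalFree d ≠ 0) (i : Fin n) :
    nodeLaw d h i = ENNReal.ofReal (((d i).toNat : ℝ) / totalFree d) := by
  rw [nodeLaw, PMF.normalize_apply, tsum_fintype, ENNReal.ofReal_div_of_pos
    (by exact_mod_cast Nat.pos_of_ne_zero h), ENNReal.ofReal_natCast, ENNReal.ofReal_natCast,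
    ENNReal.div_eq_inv_mul, mul_comm, totalFree]
  push_cast
  rfl

/-! ### Stability of the limit recursion -/

/-- Closeness on the window `[0, Λ.maxDeg]` controls the number of free sockets, hence all Poisson
means. The constants do not depend on `d`, although `d` may be arbitrarily negative, because nodes
without free sockets are never picked: the only value outside the window that matters is `d` itself.
-/
theorem exists_stability (Λ : DegreeSequence) {γ : ℝ} (hγ : 0 < γ) (t : ℕ) :
    ∃ δ₀ C : ℝ, 0 < δ₀ ∧ 0 < C ∧ ∀ (n : ℕ) (s : State n) (l : ℕ) (d : ℤ) (δ : ℝ), 0 < n →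
      ClassesLE Λ.maxDeg s → l ≤ Λ.maxDeg → 0 ≤ δ → δ ≤ δ₀ →
      (∀ l' ∈ Finset.range (Λ.maxDeg + 1), ∀ d' ∈ insert d (Finset.Icc (0 : ℤ) Λ.maxDeg),
        |stateProfile s l' d' - omega Λ γ t l' d'| ≤ δ) →
      n * (freeMass Λ γ t / 2) ≤ totalFree s.free ∧
      |potential (classNodes s l) (fun i => s.free i - d)
        (fun i => ((s.free i).toNat : ℝ) / totalFree s.free) (n * γ) 0 -
          n * omega Λ γ (t + 1) l d| ≤ n * (C * δ) := by
  have hS := freeMass_pos Λ hγ t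
  set S := freeMass Λ γ t with hSdef
  have hL2 := Λ.two_le_maxDeg
  set L := Λ.maxDeg with hL
  have hL0 : (0 : ℝ) < L := by
    have : 0 < L := by omega
    exact_mod_cast this
  set K : ℝ := (L + 1) * ((L + 1) * L) with hK
  have hK0 : 0 < K := by positivity
  refine ⟨S / (2 * K), (L + 2) + 2 * γ * L * K / S ^ 2, by positivity, by positivity, ?_⟩
  intro n s l d δ hn hs hl hδ hδ₀ hclose
  have hn' : (0 : ℝ) < n := by exact_mod_cast hn
  set M : ℝ := ∑ l ∈ Finset.range (L + 1), ∑ d ∈ Finset.Icc (0 : ℤ) L,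
    stateProfile s l d * (d.toNat : ℝ) with hM
  have htot : (totalFree s.free : ℝ) = n * M := totalFree_eq_sum_stateProfile hn hs
  have htoNat : ∀ d' : ℤ, d' ≤ L → (d'.toNat : ℝ) ≤ L := fun d' h => by
    have : d'.toNat ≤ L := by omega
    exact_mod_cast this
  have hMS : |M - S| ≤ K * δ := by
    rw [hM, hSdef, freeMass, ← Finset.sum_sub_distrib]
    calc |_| ≤ ∑ l' ∈ Finset.range (L + 1), ∑ d' ∈ Finset.Icc (0 : ℤ) L, δ * L := by
          refine (Finset.abs_sum_le_sum_abs _ _).trans (Finset.sum_le_sum fun l' hl' => ?_)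
          rw [← Finset.sum_sub_distrib]
          refine (Finset.abs_sum_le_sum_abs _ _).trans (Finset.sum_le_sum fun d' hd' => ?_)
          rw [← sub_mul, abs_mul, Nat.abs_cast]
          exact mul_le_mul (hclose l' hl' d' (Finset.mem_insert_of_mem hd'))
            (htoNat d' (Finset.mem_Icc.1 hd').2) (Nat.cast_nonneg _) hδ
      _ = K * δ := by
          simp only [Finset.sum_const, Finset.card_range, Int.card_Icc, nsmul_eq_mul]
          rw [show ((L : ℤ) + 1 - 0).toNat = L + 1 by omega, hK]
          push_cast
          ring
  have hKδ : K * δ ≤ S / 2 := by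
    rw [le_div_iff₀ (by positivity)] at hδ₀
    linarith
  have hM2 : S / 2 ≤ M := by linarith [(abs_le.1 hMS).1]
  have hM0 : 0 < M := by linarith
  refine ⟨by rw [htot]; gcongr, ?_⟩
  rw [potential_eq_sum_stateProfile hn hs, omega_succ, ← mul_sub, abs_mul, abs_of_pos hn']
  gcongr
  have hmean : ∀ d' : ℤ, n * γ * ((d'.toNat : ℝ) / totalFree s.free) =
      γ * (d'.toNat : ℝ) / M := by
    intro d'
    rw [htot]
    field_simp
  simp only [hmean]
  rw [← hSdef, ← Finset.sum_sub_distrib]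
  have hdiff : ∀ d' : ℤ, d' ≤ L → |γ * (d'.toNat : ℝ) / M - γ * (d'.toNat : ℝ) / S| ≤
      2 * γ * L * K / S ^ 2 * δ := by
    intro d' hd'
    have h1 : γ * (d'.toNat : ℝ) / M - γ * (d'.toNat : ℝ) / S =
        γ * (d'.toNat : ℝ) * (S - M) / (M * S) := by
      field_simp
    rw [h1, abs_div, abs_mul, abs_of_nonneg (by positivity : 0 ≤ γ * (d'.toNat : ℝ)),
      abs_of_pos (by positivity : 0 < M * S), abs_sub_comm]
    calc γ * (d'.toNat : ℝ) * |M - S| / (M * S) ≤ γ * L * (K * δ) / (S / 2 * S) := by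
          have := htoNat d' hd'
          gcongr
      _ = _ := by field_simp
  have hterm : ∀ d' ∈ Finset.Icc d (L : ℤ),
      |stateProfile s l d' * poissonWeight (γ * (d'.toNat : ℝ) / M) (d' - d) -
        omega Λ γ t l d' * poissonWeight (γ * (d'.toNat : ℝ) / S) (d' - d)| ≤
      ((if d' ∈ Finset.Icc (0 : ℤ) L then δ else 0) + if d' = d then δ else 0) +
        stateProfile s l d' * (2 * γ * L * K / S ^ 2 * δ) := by
    intro d' hd'
    rw [Finset.mem_Icc] at hd'
    have hp0 := poissonWeight_nonneg (by positivity : 0 ≤ γ * (d'.toNat : ℝ) / S) (d' - d)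
    have hp1 := poissonWeight_le_one (by positivity : 0 ≤ γ * (d'.toNat : ℝ) / S) (d' - d)
    have h1 : |stateProfile s l d' - omega Λ γ t l d'| *
        poissonWeight (γ * (d'.toNat : ℝ) / S) (d' - d) ≤
        (if d' ∈ Finset.Icc (0 : ℤ) L then δ else 0) + if d' = d then δ else 0 := by
      by_cases hin : d' ∈ insert d (Finset.Icc (0 : ℤ) L)
      · have h2 := hclose l (Finset.mem_range.2 (by omega)) d' hin
        have h3 : δ ≤ (if d' ∈ Finset.Icc (0 : ℤ) L then δ else 0) +
            if d' = d then δ else 0 := by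
          rw [Finset.mem_insert] at hin
          rcases hin with h | h
          · rw [if_pos h]
            split_ifs <;> linarith
          · rw [if_pos h]
            split_ifs <;> linarith
        nlinarith [abs_nonneg (stateProfile s l d' - omega Λ γ t l d')]
      -- Here `d'` is negative and differs from `d`, so its Poisson mean is `0` and it cannot move
      -- to `d`.
      · rw [Finset.mem_insert, Finset.mem_Icc, not_or] at hin
        have h4 : d'.toNat = 0 := by omega
        rw [h4, Nat.cast_zero, mul_zero, zero_div, poissonWeight_zero, if_neg (by omega), mul_zero]
        positivity
    have h5 : stateProfile s l d' * |poissonWeight (γ * (d'.toNat : ℝ) / M) (d' - d) -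
        poissonWeight (γ * (d'.toNat : ℝ) / S) (d' - d)| ≤
        stateProfile s l d' * (2 * γ * L * K / S ^ 2 * δ) :=
      mul_le_mul_of_nonneg_left ((abs_poissonWeight_sub_le (by positivity) (by positivity)
        _).trans (hdiff d' hd'.2)) (stateProfile_nonneg s l d')
    have hsplit : ∀ x y p q : ℝ, x * p - y * q = (x - y) * q + x * (p - q) := fun _ _ _ _ => by
      ring
    rw [hsplit]
    refine (abs_add_le _ _).trans (add_le_add ?_ ?_)
    · rwa [abs_mul, abs_of_nonneg hp0]
    · rwa [abs_mul, abs_of_nonneg (stateProfile_nonneg s l d')]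
  refine (Finset.abs_sum_le_sum_abs _ _).trans ((Finset.sum_le_sum hterm).trans ?_)
  rw [Finset.sum_add_distrib, Finset.sum_add_distrib, ← Finset.sum_mul, add_mul]
  have hQ : 0 ≤ 2 * γ * L * K / S ^ 2 * δ := by positivity
  refine add_le_add ?_ ((mul_le_mul_of_nonneg_right (sum_stateProfile_le_one s l _) hQ).trans
    (one_mul _).le)
  have h6 : (∑ d' ∈ Finset.Icc d (L : ℤ), if d' ∈ Finset.Icc (0 : ℤ) L then δ else 0) ≤
      (L + 1) * δ := by
    rw [← Finset.sum_filter, Finset.sum_const, nsmul_eq_mul]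
    gcongr
    have : (Finset.filter (· ∈ Finset.Icc (0 : ℤ) L) (Finset.Icc d (L : ℤ))).card ≤ L + 1 := by
      refine (Finset.card_le_card (t := Finset.Icc (0 : ℤ) L) fun x hx => ?_).trans
        (by simp)
      exact (Finset.mem_filter.1 hx).2
    exact_mod_cast this
  have h7 : (∑ d' ∈ Finset.Icc d (L : ℤ), if d' = d then δ else 0) ≤ δ := by
    rw [Finset.sum_ite_eq']
    split_ifs <;> linarith
  linarith

/-! ### Concentration over all the rounds -/

theorem prob_step_le {Λ P : DegreeSequence} {γ : ℝ} (hγ : 0 < γ) (t : ℕ) :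
    ∃ κ A B : ℝ, 0 < κ ∧ 0 < A ∧ 0 < B ∧ ∀ (n : ℕ) (F : FailureRule n) (s : State n) (l : ℕ)
      (d : ℤ) (ε : ℝ), 0 < n → ClassesLE Λ.maxDeg s → l ≤ Λ.maxDeg → 0 < ε → ε ≤ 1 →
      (∀ l' ∈ Finset.range (Λ.maxDeg + 1), ∀ d' ∈ insert d (Finset.Icc (0 : ℤ) Λ.maxDeg),
        |stateProfile s l' d' - omega Λ γ t l' d'| ≤ κ * ε) →
      prob (step P γ F t s) {s' | ε ≤ |stateProfile s' l d - omega Λ γ (t + 1) l d|} ≤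
        ENNReal.ofReal (A * Real.exp (-B * n * ε ^ 2)) := by
  obtain ⟨δ₀, C, hδ₀, hC, hstab⟩ := exists_stability Λ hγ t
  have hS := freeMass_pos Λ hγ t
  set S := freeMass Λ γ t with hSdef
  obtain ⟨A, B, hA, hB, hconc⟩ := exists_roundChecks_concentration P hγ
    (D := 2 * Λ.maxDeg / S) (by positivity)
  -- `κ * ε ≤ δ₀` permits the use of stability, and `C * κ ≤ 1 / 2` limits the inherited error to `ε
  -- / 2`. The other `ε / 2` is left to the fluctuation of the round, hence the rate `B / 4`.
  set κ : ℝ := min δ₀ (1 / (2 * C)) with hκ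
  have hκ0 : 0 < κ := lt_min hδ₀ (by positivity)
  have hκC : C * κ ≤ 1 / 2 := by
    have := mul_le_mul_of_nonneg_left (min_le_right δ₀ (1 / (2 * C))) hC.le
    refine this.trans (le_of_eq ?_)
    field_simp
  refine ⟨κ, A, B / 4, hκ0, hA, by positivity, ?_⟩
  intro n F s l d ε hn hs hl hε hε1 hclose
  have hn' : (0 : ℝ) < n := by exact_mod_cast hn
  have hκε : κ * ε ≤ δ₀ := by
    have := min_le_left δ₀ (1 / (2 * C))
    nlinarith
  obtain ⟨hfree, hpot⟩ := hstab n s l d (κ * ε) hn hs hl (by positivity) hκε hclose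
  have hpos : (0 : ℝ) < totalFree s.free := lt_of_lt_of_le (by positivity) hfree
  have htot : totalFree s.free ≠ 0 := by
    intro h
    rw [h, Nat.cast_zero] at hpos
    exact lt_irrefl _ hpos
  set W : Fin n → ℝ := fun i => ((s.free i).toNat : ℝ) / totalFree s.free with hW
  have hW0 : ∀ i, 0 ≤ W i := fun i => by positivity
  have hW1 : ∑ i, W i = 1 := by
    rw [hW, ← Finset.sum_div, div_eq_one_iff_eq hpos.ne', totalFree]
    push_cast
    rfl
  have hWD : ∀ i, n * W i ≤ 2 * Λ.maxDeg / S := by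
    intro i
    have h1 : ((s.free i).toNat : ℝ) ≤ Λ.maxDeg := by
      have := hs.free_le i
      have : (s.free i).toNat ≤ Λ.maxDeg := by omega
      exact_mod_cast this
    calc n * W i ≤ n * (Λ.maxDeg / (n * (S / 2))) :=
          mul_le_mul_of_nonneg_left (div_le_div₀ (Nat.cast_nonneg _) h1 (by positivity) hfree)
            hn'.le
      _ = _ := by field_simp
  rw [step, dif_pos htot, prob_map]
  refine (prob_mono _ fun C' _ hC' => ?_).trans ((hconc n (classNodes s l)
    (fun i => s.free i - d) W _ (nodeLaw_apply _ htot) hW0 hW1 hWD t (ε / 2) (by positivity)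
    (by linarith)).trans (ENNReal.ofReal_le_ofReal (le_of_eq (by ring_nf))))
  change ε ≤ |stateProfile (s.add C') l d - omega Λ γ (t + 1) l d| at hC'
  change n * (ε / 2) ≤ |_|
  rw [← mul_stateProfile_add hn s C' l d W]
  have h1 := mul_le_mul_of_nonneg_left hC' hn'.le
  rw [← abs_of_pos hn', ← abs_mul, abs_of_pos hn', mul_sub] at h1
  have h2 := abs_sub_le (n * stateProfile (s.add C') l d)
    (potential (classNodes s l) (fun i => s.free i - d) W (n * γ) 0)
    (n * omega Λ γ (t + 1) l d)
  have h3 : n * (C * (κ * ε)) ≤ n * (ε / 2) := by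
    have := mul_le_mul_of_nonneg_right hκC hε.le
    exact mul_le_mul_of_nonneg_left (by linarith) hn'.le
  linarith

theorem stateProfile_initial {Λ : DegreeSequence} {n : Blocklength Λ} {s : State n.1}
    (hs : s ∈ (initialLaw Λ n).support) (γ : ℝ) {l : ℕ} (hl : l ≤ Λ.maxDeg) (d : ℤ) :
    stateProfile s l d = omega Λ γ 0 l d := by
  rw [initialLaw, PMF.mem_support_map_iff] at hs
  obtain ⟨f, hf, rfl⟩ := hs
  rw [PMF.mem_support_uniformOfFinset_iff, assignments, Finset.mem_filter] at hf
  have hn : (n.1 : ℝ) ≠ 0 := by exact_mod_cast n.2.1.ne'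
  have h := hf.2 ⟨l, Nat.lt_succ_of_le hl⟩
  simp only [stateProfile, omega, nodeClass, varDegree_nil, Nat.cast_zero, add_zero]
  rw [div_eq_iff hn]
  split_ifs with hd
  · subst hd
    rw [mul_comm, ← h]
    congr 2
    ext i
    simp [Fin.ext_iff]
  · rw [zero_mul, Nat.cast_eq_zero, Finset.card_eq_zero, Finset.filter_eq_empty_iff]
    rintro i - ⟨h1, h2⟩
    exact hd (h2.symm.trans h1)

/-- Induction on the round: a union bound over the `(L + 1) * (L + 2)` or fewer coordinates that
influence `(l, d)` bounds the bad event `G`, and off `G` the one-round estimate applies. The initial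
profile is deterministic, so the induction starts without error. -/
theorem exists_stateLaw_concentration (Λ P : DegreeSequence) {γ : ℝ} (hγ : 0 < γ) (t : ℕ) :
    ∃ A B : ℝ, 0 < A ∧ 0 < B ∧ ∀ (n : Blocklength Λ) (F : FailureRule n.1) (l : ℕ) (d : ℤ)
      (ε : ℝ), l ≤ Λ.maxDeg → 0 < ε →
      prob (stateLaw Λ P γ n F t) {s | ε ≤ |stateProfile s l d - omega Λ γ t l d|} ≤
        ENNReal.ofReal (A * Real.exp (-B * n.1 * ε ^ 2)) := by
  induction t with
  | zero =>
    refine ⟨1, 1, one_pos, one_pos, fun n F l d ε hl hε => ?_⟩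
    rw [prob_eq_zero]
    · exact zero_le
    · intro s hs h
      change ε ≤ |_| at h
      rw [stateProfile_initial hs γ hl d, sub_self, abs_zero] at h
      linarith
  | succ t ih =>
    obtain ⟨A, B, hA, hB, hprev⟩ := ih
    obtain ⟨κ, A', B', hκ, hA', hB', hstep⟩ := prob_step_le (Λ := Λ) (P := P) hγ t
    set L := Λ.maxDeg with hL
    set B'' : ℝ := min (B * κ ^ 2) B' with hB''
    refine ⟨(L + 1) * (L + 2) * A + A', B'', by positivity, lt_min (by positivity) hB', ?_⟩
    intro n F l d ε hl hε
    -- The one-round estimate needs `ε ≤ 1`; a larger deviation is impossible, both quantities lying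
    -- in `[0, 1]`.
    rcases lt_or_ge 1 ε with hε1 | hε1
    · rw [prob_eq_zero]
      · exact zero_le
      · intro s _ h
        change ε ≤ |_| at h
        have : |stateProfile s l d - omega Λ γ (t + 1) l d| ≤ 1 := abs_sub_le_iff.2
          ⟨by linarith [stateProfile_le_one s l d, omega_nonneg Λ hγ (t + 1) l d],
            by linarith [stateProfile_nonneg s l d, omega_le_one Λ hγ (t + 1) hl d]⟩
        linarith
    set J := Finset.range (L + 1) ×ˢ insert d (Finset.Icc (0 : ℤ) L) with hJ
    set G : Set (State n.1) := ⋃ j ∈ J,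
      {s | κ * ε ≤ |stateProfile s j.1 j.2 - omega Λ γ t j.1 j.2|} with hG
    have hJcard : (J.card : ℝ) ≤ (L + 1) * (L + 2) := by
      have : J.card ≤ (L + 1) * (L + 2) := by
        rw [hJ, Finset.card_product, Finset.card_range]
        gcongr
        exact (Finset.card_insert_le _ _).trans (by simp)
      exact_mod_cast this
    have hGprob : prob (stateLaw Λ P γ n F t) G ≤
        ENNReal.ofReal ((L + 1) * (L + 2) * A * Real.exp (-B'' * n.1 * ε ^ 2)) := by
      refine (prob_biUnion_le _ _ _).trans ?_
      calc _ ≤ ∑ _j ∈ J, ENNReal.ofReal (A * Real.exp (-B'' * n.1 * ε ^ 2)) := by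
            refine Finset.sum_le_sum fun j hj => ?_
            refine (hprev n F j.1 j.2 (κ * ε) ?_ (by positivity)).trans ?_
            · have := Finset.mem_range.1 (Finset.mem_product.1 hj).1
              omega
            · gcongr ENNReal.ofReal (A * Real.exp ?_)
              have h1 := mul_le_mul_of_nonneg_right (min_le_left (B * κ ^ 2) B')
                (by positivity : 0 ≤ n.1 * ε ^ 2)
              rw [← hB''] at h1
              linarith
        _ ≤ _ := by
            rw [Finset.sum_const, nsmul_eq_mul, ← ENNReal.ofReal_natCast,
              ← ENNReal.ofReal_mul (Nat.cast_nonneg _), mul_assoc _ A]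
            gcongr
    rw [stateLaw, prob_bind]
    have hpoint : ∀ s ∈ (stateLaw Λ P γ n F t).support,
        prob (step P γ F t s) {s' | ε ≤ |stateProfile s' l d - omega Λ γ (t + 1) l d|} ≤
        G.indicator 1 s + ENNReal.ofReal (A' * Real.exp (-B'' * n.1 * ε ^ 2)) := by
      intro s hs
      by_cases hsG : s ∈ G
      · rw [Set.indicator_of_mem hsG]
        exact (prob_le_one _ _).trans le_self_add
      · refine le_add_left ((hstep n.1 F s l d ε n.2.1 (classesLE_of_mem_support hs) hl hε hε1
          ?_).trans ?_)
        · intro l' hl' d' hd'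
          by_contra h
          refine hsG ?_
          rw [hG, Set.mem_iUnion₂]
          exact ⟨(l', d'), Finset.mem_product.2 ⟨hl', hd'⟩, (not_le.1 h).le⟩
        · gcongr ENNReal.ofReal (A' * Real.exp ?_)
          have h1 := mul_le_mul_of_nonneg_right (min_le_right (B * κ ^ 2) B')
            (by positivity : 0 ≤ n.1 * ε ^ 2)
          rw [← hB''] at h1
          linarith
    refine (expect_mono _ hpoint).trans ?_
    rw [expect_add, expect_const, add_mul, ENNReal.ofReal_add (by positivity) (by positivity)]
    gcongr
    exact hGprob

/-! ### The degree profile of the graph -/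

/-- A node of class `l` has degree `m` exactly when it has `l - m` free sockets. -/
theorem degreeProfile_eq_sum_stateProfile {n L : ℕ} {s : State n} (hs : ClassesLE L s) (m : ℕ) :
    degreeProfile s.graph m =
      ∑ l ∈ Finset.range (L + 1), stateProfile s l ((l : ℤ) - m) := by
  unfold degreeProfile stateProfile
  rw [← Finset.sum_div]
  congr 1
  rw [Finset.card_eq_sum_card_fiberwise (f := fun i => (nodeClass s i).toNat)
    (t := Finset.range (L + 1))]
  · push_cast
    refine Finset.sum_congr rfl fun l _ => ?_
    congr 2
    rw [Finset.filter_filter]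
    ext i
    have := (hs i).1
    simp only [Finset.mem_filter, Finset.mem_univ, true_and]
    unfold nodeClass at *
    omega
  · intro i _
    have := hs i
    simp only [Finset.coe_range, Set.mem_Iio]
    omega

theorem degreeProfile_nonneg {n : ℕ} (G : TannerGraph n) (l : ℕ) : 0 ≤ degreeProfile G l := by
  unfold degreeProfile
  positivity

theorem sum_degreeProfile_le_one {n : ℕ} (G : TannerGraph n) (S : Finset ℕ) :
    ∑ l ∈ S, degreeProfile G l ≤ 1 := by
  unfold degreeProfile
  rw [← Finset.sum_div]
  refine div_le_one_of_le₀ ?_ n.cast_nonneg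
  have h : (∑ l ∈ S, (Finset.univ.filter fun i : Fin n => varDegree G i = l).card) ≤ n := by
    rw [← Finset.card_biUnion]
    · exact (Finset.card_le_univ _).trans (Fintype.card_fin n).le
    · intro x _ y _ hxy
      rw [Function.onFun, Finset.disjoint_left]
      intro i hi hi'
      rw [Finset.mem_filter] at hi hi'
      exact hxy (hi.2.symm.trans hi'.2)
  exact_mod_cast h

theorem degreeProfile_le_one {n : ℕ} (G : TannerGraph n) (l : ℕ) : degreeProfile G l ≤ 1 := by
  simpa using sum_degreeProfile_le_one G {l}

theorem exists_ensemble_concentration (Λ P : DegreeSequence) {γ : ℝ} (hγ : 0 < γ) :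
    ∃ A B : ℝ, 0 < A ∧ 0 < B ∧ ∀ (n : Blocklength Λ) (F : FailureRule n.1) (l : ℕ) (ε : ℝ),
      0 < ε → (ensemble Λ P γ n F).real {G | ε ≤ |degreeProfile G l - limitProfile Λ γ l|} ≤
        A * Real.exp (-B * n.1 * ε ^ 2) := by
  obtain ⟨A, B, hA, hB, hconc⟩ := exists_stateLaw_concentration Λ P hγ (numRounds Λ γ)
  set L := Λ.maxDeg with hL
  refine ⟨(L + 1) * A, B / (L + 1) ^ 2, by positivity, by positivity, ?_⟩
  intro n F m ε hε
  rw [measureReal_def]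
  refine ENNReal.toReal_le_of_le_ofReal (by positivity) ?_
  rw [ensemble, toMeasure_eq_prob _ (MeasurableSpace.measurableSet_top), prob_map]
  have hsub : ∀ s ∈ (stateLaw Λ P γ n F (numRounds Λ γ)).support,
      s ∈ State.graph ⁻¹' {G | ε ≤ |degreeProfile G m - limitProfile Λ γ m|} →
      s ∈ ⋃ l ∈ Finset.range (L + 1), {s : State n.1 | ε / (L + 1) ≤
        |stateProfile s l ((l : ℤ) - m) - omega Λ γ (numRounds Λ γ) l ((l : ℤ) - m)|} := by
    intro s hs h
    change ε ≤ |degreeProfile s.graph m - limitProfile Λ γ m| at h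
    by_contra hnot
    simp only [Set.mem_iUnion, not_exists] at hnot
    rw [degreeProfile_eq_sum_stateProfile (classesLE_of_mem_support hs), limitProfile,
      ← Finset.sum_sub_distrib] at h
    have h1 : ∑ l ∈ Finset.range (L + 1),
        |stateProfile s l ((l : ℤ) - m) - omega Λ γ (numRounds Λ γ) l ((l : ℤ) - m)| <
        ∑ _l ∈ Finset.range (L + 1), ε / (L + 1) :=
      Finset.sum_lt_sum_of_nonempty (by simp) fun l hl => not_le.1 (hnot l hl)
    rw [Finset.sum_const, Finset.card_range, nsmul_eq_mul] at h1
    have h2 : ((L + 1 : ℕ) : ℝ) * (ε / (L + 1)) = ε := by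
      push_cast
      field_simp
    rw [h2] at h1
    exact absurd (h.trans (Finset.abs_sum_le_sum_abs _ _)) (not_le.2 h1)
  refine (prob_mono _ hsub).trans ((prob_biUnion_le _ _ _).trans ?_)
  calc _ ≤ ∑ _l ∈ Finset.range (L + 1),
        ENNReal.ofReal (A * Real.exp (-B * n.1 * (ε / (L + 1)) ^ 2)) := by
        refine Finset.sum_le_sum fun l hl => hconc n F l _ _ ?_ (by positivity)
        have := Finset.mem_range.1 hl
        omega
    _ = _ := by
        rw [Finset.sum_const, Finset.card_range, nsmul_eq_mul, ← ENNReal.ofReal_natCast,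
          ← ENNReal.ofReal_mul (Nat.cast_nonneg _), ← mul_assoc]
        congr 2
        · push_cast
          rfl
        · congr 1
          field_simp

/-! ### Convergence of the expected profile -/

section Expectation

variable {Λ P : DegreeSequence} {γ : ℝ} {n : Blocklength Λ} {F : FailureRule n.1}

instance : IsProbabilityMeasure (ensemble Λ P γ n F) := by
  unfold ensemble
  infer_instance

theorem integrable_degreeProfile (l : ℕ) :
    Integrable (fun G => degreeProfile G l) (ensemble Λ P γ n F) := by
  refine Integrable.of_bound (C := 1) measurable_from_top.aestronglyMeasurable
    (Eventually.of_forall fun G => ?_)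
  rw [Real.norm_eq_abs, abs_of_nonneg (degreeProfile_nonneg G l)]
  exact degreeProfile_le_one G l

theorem expectedProfile_nonneg (l : ℕ) : 0 ≤ expectedProfile Λ P γ n F l :=
  integral_nonneg fun G => degreeProfile_nonneg G l

theorem sum_expectedProfile_le_one (S : Finset ℕ) :
    ∑ l ∈ S, expectedProfile Λ P γ n F l ≤ 1 := by
  unfold expectedProfile
  rw [← integral_finsetSum S fun l _ => integrable_degreeProfile l]
  calc _ ≤ ∫ _G, (1 : ℝ) ∂(ensemble Λ P γ n F) :=
        integral_mono (integrable_finsetSum S fun l _ => integrable_degreeProfile l)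
          (integrable_const 1) fun G => sum_degreeProfile_le_one G S
    _ = 1 := by simp

theorem abs_expectedProfile_sub_le (hγ : 0 < γ) (l : ℕ) {η : ℝ} (hη : 0 < η) :
    |expectedProfile Λ P γ n F l - limitProfile Λ γ l| ≤
      η + (ensemble Λ P γ n F).real {G | η ≤ |degreeProfile G l - limitProfile Λ γ l|} := by
  classical
  set S : Set (TannerGraph n.1) := {G | η ≤ |degreeProfile G l - limitProfile Λ γ l|} with hS
  have hSm : MeasurableSet S := MeasurableSpace.measurableSet_top
  have hint := (integrable_degreeProfile (Λ := Λ) (P := P) (γ := γ) (n := n) (F := F) l).sub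
    (integrable_const (limitProfile Λ γ l))
  have hind : Integrable (S.indicator (1 : TannerGraph n.1 → ℝ)) (ensemble Λ P γ n F) :=
    (integrable_const (1 : ℝ)).indicator hSm
  have h1 : expectedProfile Λ P γ n F l - limitProfile Λ γ l =
      ∫ G, (degreeProfile G l - limitProfile Λ γ l) ∂(ensemble Λ P γ n F) := by
    rw [integral_sub (integrable_degreeProfile l) (integrable_const _)]
    simp [expectedProfile]
  rw [h1]
  refine abs_integral_le_integral_abs.trans ?_
  calc _ ≤ ∫ G, (η + S.indicator (1 : TannerGraph n.1 → ℝ) G) ∂(ensemble Λ P γ n F) := by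
        refine integral_mono hint.abs ((integrable_const η).add hind) fun G => ?_
        by_cases hG : G ∈ S
        · have : |degreeProfile G l - limitProfile Λ γ l| ≤ 1 := abs_sub_le_iff.2
            ⟨by linarith [degreeProfile_le_one G l, limitProfile_nonneg Λ hγ l],
              by linarith [degreeProfile_nonneg G l, limitProfile_le_one Λ hγ l]⟩
          simp only [Set.indicator_of_mem hG, Pi.one_apply]
          linarith
        · have : ¬ η ≤ |degreeProfile G l - limitProfile Λ γ l| := hG
          simp only [Set.indicator_of_notMem hG]
          linarith
    _ = _ := by
        rw [integral_add (integrable_const η) hind, integral_indicator_one hSm]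
        simp

end Expectation

theorem tendsto_expectedProfile (Λ P : DegreeSequence) {γ : ℝ} (hγ : 0 < γ)
    (F : (n : Blocklength Λ) → FailureRule n.1) (l : ℕ) :
    Tendsto (fun n => expectedProfile Λ P γ n (F n) l) (blocklengthLimit Λ)
      (𝓝 (limitProfile Λ γ l)) := by
  obtain ⟨A, B, hA, hB, hconc⟩ := exists_ensemble_concentration Λ P hγ
  rw [Metric.tendsto_nhds]
  intro ε hε
  have hlim : Tendsto (fun n : Blocklength Λ => A * Real.exp (-(B * (ε / 2) ^ 2 * n.1)))
      (blocklengthLimit Λ) (𝓝 0) := by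
    have h1 : Tendsto (fun n : Blocklength Λ => ((n.1 : ℕ) : ℝ)) (blocklengthLimit Λ) atTop :=
      tendsto_natCast_atTop_atTop.comp tendsto_comap
    have h2 := Real.tendsto_exp_neg_atTop_nhds_zero.comp
      (h1.const_mul_atTop (by positivity : 0 < B * (ε / 2) ^ 2))
    simpa using h2.const_mul A
  filter_upwards [hlim.eventually_lt_const (by positivity : (0 : ℝ) < ε / 2)] with n hn
  rw [Real.dist_eq]
  refine (abs_expectedProfile_sub_le hγ l (by positivity : 0 < ε / 2)).trans_lt ?_
  have h3 := hconc n (F n) l (ε / 2) (by positivity)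
  rw [show -B * n.1 * (ε / 2) ^ 2 = -(B * (ε / 2) ^ 2 * n.1) by ring] at h3
  linarith

/-- Scheffé's lemma: pointwise convergence of sub-probability weights to probability weights is
convergence in `ℓ¹`. -/
theorem tendsto_tsum_ofReal_abs_sub {ι : Type*} {f : Filter ι} {μ : ι → ℕ → ℝ} {ν : ℕ → ℝ}
    (hμ : ∀ i l, 0 ≤ μ i l) (hμ1 : ∀ i (S : Finset ℕ), ∑ l ∈ S, μ i l ≤ 1) (hν : ∀ l, 0 ≤ ν l)
    (hν1 : HasSum ν 1) (h : ∀ l, Tendsto (fun i => μ i l) f (𝓝 (ν l))) :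
    Tendsto (fun i => ∑' l, ENNReal.ofReal |μ i l - ν l|) f (𝓝 0) := by
  have hμs : ∀ i, Summable (μ i) := fun i => summable_of_sum_le (hμ i) (hμ1 i)
  have hbound : ∀ i l, ‖max (ν l - μ i l) 0‖ ≤ ν l := by
    intro i l
    rw [Real.norm_eq_abs, abs_of_nonneg (le_max_right _ _)]
    exact max_le (by linarith [hμ i l]) (hν l)
  have hpos : ∀ i, Summable fun l => max (ν l - μ i l) 0 := fun i =>
    Summable.of_norm_bounded hν1.summable (hbound i)
  have hlim : Tendsto (fun i => ∑' l, max (ν l - μ i l) 0) f (𝓝 0) := by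
    have := tendsto_tsum_of_dominated_convergence (𝓕 := f)
      (f := fun i l => max (ν l - μ i l) 0) (g := fun _ => 0) hν1.summable
      (fun l => by
        have := ((tendsto_const_nhds (x := ν l)).sub (h l)).max (tendsto_const_nhds (x := 0))
        simpa using this)
      (Eventually.of_forall hbound)
    simpa using this
  have hlim2 : Tendsto (fun i => ENNReal.ofReal (2 * ∑' l, max (ν l - μ i l) 0)) f (𝓝 0) := by
    have := ENNReal.tendsto_ofReal (hlim.const_mul 2)
    simpa using this
  refine tendsto_of_tendsto_of_tendsto_of_le_of_le tendsto_const_nhds hlim2 (fun _ => zero_le)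
    fun i => ?_
  -- `|μ - ν| = (μ - ν) + 2 * max (ν - μ) 0`. The first part has non-positive sum, since `μ` has
  -- mass at most `1` and `ν` has mass `1`; the second tends to `0` by domination by `ν`.
  have hsum := ((hμs i).hasSum.sub hν1).add ((hpos i).hasSum.mul_left 2)
  have heq : (fun l => μ i l - ν l + 2 * max (ν l - μ i l) 0) = fun l => |μ i l - ν l| := by
    funext l
    rcases le_total (ν l) (μ i l) with h' | h'
    · rw [max_eq_right (by linarith), abs_of_nonneg (by linarith)]
      ring
    · rw [max_eq_left (by linarith), abs_of_nonpos (by linarith)]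
      ring
  rw [heq] at hsum
  change ∑' l, ENNReal.ofReal |μ i l - ν l| ≤ _
  rw [← ENNReal.ofReal_tsum_of_nonneg (fun _ => abs_nonneg _) hsum.summable, hsum.tsum_eq]
  refine ENNReal.ofReal_le_ofReal ?_
  have : ∑' l, μ i l ≤ 1 := (hμs i).tsum_le_of_sum_le (hμ1 i)
  linarith

theorem tendsto_tvDist (Λ P : DegreeSequence) {γ : ℝ} (hγ : 0 < γ)
    (F : (n : Blocklength Λ) → FailureRule n.1) :
    Tendsto (fun n => tvDist (expectedProfile Λ P γ n (F n)) (limitProfile Λ γ))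
      (blocklengthLimit Λ) (𝓝 0) := by
  have h := tendsto_tsum_ofReal_abs_sub (fun n l => expectedProfile_nonneg l)
    (fun n S => sum_expectedProfile_le_one S) (limitProfile_nonneg Λ hγ)
    (hasSum_limitProfile Λ hγ) (tendsto_expectedProfile Λ P hγ F)
  have h2 := ENNReal.Tendsto.div_const h (b := 2) (Or.inr two_ne_zero)
  simpa [tvDist] using h2

end MultiPoisson

end

theorem mainTheorem4 (Λ P : MultiPoisson.DegreeSequence) (γ : ℝ) (hγ : 0 < γ) :
    ∃ A B : ℝ, 0 < A ∧ 0 < B ∧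
      ∀ F : (n : MultiPoisson.Blocklength Λ) → MultiPoisson.FailureRule n.1,
        (∀ l : ℕ, Tendsto (fun n => MultiPoisson.expectedProfile Λ P γ n (F n) l)
          (MultiPoisson.blocklengthLimit Λ) (𝓝 (MultiPoisson.limitProfile Λ γ l))) ∧
        Tendsto (fun n => MultiPoisson.tvDist (MultiPoisson.expectedProfile Λ P γ n (F n))
            (MultiPoisson.limitProfile Λ γ))
          (MultiPoisson.blocklengthLimit Λ) (𝓝 0) ∧
        ∀ (l : ℕ) (n : MultiPoisson.Blocklength Λ) (ε : ℝ), 0 < ε →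
          (MultiPoisson.ensemble Λ P γ n (F n)).real
              {G | ε ≤ |MultiPoisson.degreeProfile G l - MultiPoisson.limitProfile Λ γ l|} ≤
            A * Real.exp (-B * n.1 * ε ^ 2) := by
  obtain ⟨A, B, hA, hB, hconc⟩ := MultiPoisson.exists_ensemble_concentration Λ P hγ
  exact ⟨A, B, hA, hB, fun F => ⟨MultiPoisson.tendsto_expectedProfile Λ P hγ F,
    MultiPoisson.tendsto_tvDist Λ P hγ F, fun l n ε hε => hconc n (F n) l ε hε⟩⟩
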